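/- A language $L\subseteq\Sigma^*$ is \emph{generalized definite} if there is an integer $m\ge 0$ such that for all $x_1,x_2\in\Sigma^m$ and all $y\in\Sigma^*$ one has $x_1yx_2\in L\Leftrightarrow x_1x_2\in L$. The problem GenDef is: given a finite (complete, deterministic) automaton $\mathbb{A}=(Q,\Sigma,\delta,q_0,F)$ over a nonempty finite alphabet, is the language $L(\mathbb{A})$ recognized by $\mathbb{A}$ generalized definite? Here the automaton is given by $n=|Q|$, $k=|\Sigma|$, the start state $q_0$, the characteristic vector of $F$ and the transition table of $\delta$, stored in consecutive memory cells (states and letters being numbered $0,\dots,n-1$ and $0,\dots,k-1$). Time is the number of executed instructions of a deterministic random access machine on natural numbers with unit cost whose operations are loading constants, copying, addition, truncated subtraction, indirect load and store, jumps, conditional jumps on a comparison, and halting with answer yes or no. \textbf{Theorem.} GenDef can be solved in quadratic deterministic time in the RAM model: there are a single RAM program and a constant $C$ such that for every automaton $\mathbb{A}$ with $n$ states over an alphabet of $k\ge 1$ letters, the program halts after at most $C\,k\,n^2$ steps and answers yes if and only if $L(\mathbb{A})$ is generalized definite. In particular, the time is $O(n^2)$ in the number $n$ of states for each fixed alphabet,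 and it is $O(N^2)$ for $N=nk$, the size of the transition table. -/

import Mathlib

/-- A language `L` is generalized definite if for some constant `m ≥ 0` and all words `x₁`, `x₂` of
length `m` and every word `y`, `x₁ y x₂ ∈ L` if and only if `x₁ x₂ ∈ L`. -/
def Language.IsGeneralizedDefinite {α : Type*} (L : Language α) : Prop :=
  ∃ m : ℕ, ∀ x₁ x₂ y : List α, x₁.length = m → x₂.length = m →
    (x₁ ++ y ++ x₂ ∈ L ↔ x₁ ++ x₂ ∈ L)

namespace RAM

/-- The instructions of a random access machine. The machine has registers and a memory, both
indexed by `ℕ` and holding natural numbers; a program names only finitely many registers, and the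
memory is reached by indirect addressing through them. -/
inductive Instr where
  /-- `const d c`: put the number `c` into register `d`. -/
  | const (d c : ℕ)
  /-- `move d s`: copy register `s` to register `d`. -/
  | move (d s : ℕ)
  /-- `add d a b`: put the sum of registers `a` and `b` into register `d`. -/
  | add (d a b : ℕ)
  /-- `sub d a b`: put the truncated difference of registers `a` and `b` into register `d`. -/
  | sub (d a b : ℕ)
  /-- `load d a`: copy the memory cell whose address is in register `a` to register `d`. -/
  | load (d a : ℕ)
  /-- `store a s`: copy register `s` to the memory cell whose address is in register `a`. -/
  | store (a s : ℕ)
  /-- `jump l`: continue with instruction number `l`. -/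
  | jump (l : ℕ)
  /-- `jumpLt a b l`: if register `a` is smaller than register `b`, continue with instruction
  number `l`, otherwise with the next instruction. -/
  | jumpLt (a b l : ℕ)
  /-- `halt b`: stop with the answer `b`. -/
  | halt (b : Bool)

/-- A program is a finite list of instructions, numbered from `0`. -/
abbrev Program := List Instr

/-- A configuration: the number of the current instruction, the registers and the memory. -/
structure Config where
  pc : ℕ
  reg : ℕ → ℕ
  mem : ℕ → ℕ

/-- The effect of one instruction. -/
def Instr.exec : Instr → Config → Config
  | .const d c, s => ⟨s.pc + 1, Function.update s.reg d c, s.mem⟩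
  | .move d a, s => ⟨s.pc + 1, Function.update s.reg d (s.reg a), s.mem⟩
  | .add d a b, s => ⟨s.pc + 1, Function.update s.reg d (s.reg a + s.reg b), s.mem⟩
  | .sub d a b, s => ⟨s.pc + 1, Function.update s.reg d (s.reg a - s.reg b), s.mem⟩
  | .load d a, s => ⟨s.pc + 1, Function.update s.reg d (s.mem (s.reg a)), s.mem⟩
  | .store a b, s => ⟨s.pc + 1, s.reg, Function.update s.mem (s.reg a) (s.reg b)⟩
  | .jump l, s => ⟨l, s.reg, s.mem⟩
  | .jumpLt a b l, s => ⟨if s.reg a < s.reg b then l else s.pc + 1, s.reg, s.mem⟩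
  | .halt _, s => s

/-- One step of a program: it executes the current instruction. If there is no instruction with the
current number, the machine is stuck (and gives no answer). -/
def Program.step (P : Program) (s : Config) : Config :=
  match P[s.pc]? with
  | some i => i.exec s
  | none => s

/-- The initial configuration on an input list: the list stands in the memory cells `0, 1, 2, …`,
and all other cells and all registers hold `0`. -/
def init (input : List ℕ) : Config where
  pc := 0
  reg := fun _ => 0
  mem := fun i => input.getD i 0

/-- On the given input, the program reaches an instruction `halt b` after at most `t` steps.
Every instruction costs one step (uniform cost). -/
def Program.AnswersWithin (P : Program) (input : List ℕ) (b : Bool) (t : ℕ) : Prop :=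
  ∃ i ≤ t, P[(P.step^[i] (init input)).pc]? = some (.halt b)

open Classical in
/-- The representation of a finite automaton with states `0, …, n - 1` and letters `0, …, k - 1`:
the numbers `n` and `k`, the start state, the characteristic vector of the set of final states, and
the transition table, row by row (entry `q * k + a` of the table is the state `q · a`). -/
noncomputable def encode {n k : ℕ} (A : DFA (Fin k) (Fin n)) : List ℕ :=
  [n, k, (A.start : ℕ)] ++
    List.ofFn (fun q : Fin n => if q ∈ A.accept then 1 else 0) ++
    List.ofFn (fun i : Fin (n * k) => (A.step i.divNat i.modNat : ℕ))

end RAM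

/-! ### Generalized definiteness and cycles of critical pairs -/

namespace DFA

variable {α σ : Type*} (A : DFA α σ)

/-! Generalized definiteness is a cycle condition: no critical pair `(p, q)` is fixed by a nonempty
word. If `x` fixes both states of a critical pair, `u` leads to `p`, `y` leads from `p` to `q` and
`z` separates them, then `u x^m y x^m z` and `u x^m x^m z` refute every bound `m`. Conversely, a
sufficiently long prefix and suffix each contain a factor that acts as a loop, and some power of it
acts idempotently. Without critical cycles, `r·e` and `r·ete` are equivalent for every reachable
`r`, every nonempty `e` acting idempotently and every `t`; applied to the idempotents of prefix and
suffix, this erases the middle word (`isGeneralizedDefinite_of_noCriticalCycle`).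

A critical pair on a cycle makes the whole cycle critical. Hence the condition says that every path
of the product automaton leaves the critical set, which is the least fixed point `SafePair`.

What remains is to compute three least fixed points on the `n * n` pairs of states, each in a graph
with `k` edges per vertex. Reachability follows the edges `(p, q) → (p·a, q)` to the diagonal, so
one graph handles all sources at once. Inequivalence needs one successor in the set, safety needs
all `k`. A single algorithm, `wp_propagateCmd`, serves all three: each vertex has a counter of
missing edges, and vertices whose counter reaches zero are queued and scanned once through reversed
adjacency lists. Every edge is handled at most once, so the cost is `O(k n^2)`.

For the machine, the algorithm is written in a small structured language with a timed semantics.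
Correctness and time are proved together with `wp`, and `Exec.simulate` transfers both to the
compiled code with a constant factor. -/

/-- A pair of states is critical if the first one is reachable from the start state, the second one
from the first one, and the two accept different languages. -/
def IsCritical (p q : σ) : Prop :=
  (∃ u, A.eval u = p) ∧ (∃ y, A.evalFrom p y = q) ∧ A.acceptsFrom p ≠ A.acceptsFrom q

/-- No critical pair lies on a cycle of the product automaton. -/
def NoCriticalCycle : Prop :=
  ∀ p q x, A.IsCritical p q → x ≠ [] → A.evalFrom p x = p → A.evalFrom q x ≠ q

/-- The pairs of states from which every path in the product automaton leaves the set of critical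
pairs. -/
inductive SafePair : σ → σ → Prop
  | base {p q} : ¬ A.IsCritical p q → SafePair p q
  | step {p q} : (∀ a, SafePair (A.step p a) (A.step q a)) → SafePair p q

theorem mem_acceptsFrom_evalFrom {p : σ} {x y : List α} :
    y ∈ A.acceptsFrom (A.evalFrom p x) ↔ x ++ y ∈ A.acceptsFrom p := by
  simp [mem_acceptsFrom, evalFrom_of_append]

theorem acceptsFrom_evalFrom_congr {p q : σ} (h : A.acceptsFrom p = A.acceptsFrom q)
    (x : List α) : A.acceptsFrom (A.evalFrom p x) = A.acceptsFrom (A.evalFrom q x) := by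
  ext y
  rw [mem_acceptsFrom_evalFrom, mem_acceptsFrom_evalFrom, h]

theorem eval_append (u v : List α) : A.eval (u ++ v) = A.evalFrom (A.eval u) v :=
  A.evalFrom_of_append _ _ _

theorem evalFrom_flatten_replicate (x : List α) (m : ℕ) (p : σ) :
    A.evalFrom p (List.replicate m x).flatten = (fun s => A.evalFrom s x)^[m] p := by
  induction m generalizing p with
  | zero => simp
  | succ m ih => simp [List.replicate_succ, evalFrom_of_append, ih]

/-- A critical pair on the cycle `a x` moves under `a` to a pair on the rotated cycle `x a`, which
is again critical: if its states were equivalent, reading `x` would make the original ones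
equivalent. So induction on safety never reaches its base case. -/
theorem noCriticalCycle_of_forall_safePair (h : ∀ p q, A.SafePair p q) : A.NoCriticalCycle := by
  suffices H : ∀ p q, A.SafePair p q → ∀ x, A.IsCritical p q → x ≠ [] → A.evalFrom p x = p →
      A.evalFrom q x ≠ q from fun p q x => H p q (h p q) x
  intro p q hpq
  induction hpq with
  | base hn => exact fun x hc => absurd hc hn
  | @step p q _ ih =>
    rintro x ⟨⟨u, hu⟩, ⟨y, hy⟩, hne⟩ hx hp hq
    cases x with
    | nil => exact hx rfl
    | cons a x =>
      rw [evalFrom_cons] at hp hq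
      refine ih a (x ++ [a]) ⟨⟨u ++ [a], by simp [hu]⟩, ⟨x ++ y ++ [a], ?_⟩, ?_⟩ (by simp) ?_ ?_
      · rw [evalFrom_of_append, evalFrom_of_append, hp, hy, evalFrom_singleton]
      · intro he
        exact hne (by simpa [hp, hq] using A.acceptsFrom_evalFrom_congr he x)
      · rw [evalFrom_of_append, hp, evalFrom_singleton]
      · rw [evalFrom_of_append, hq, evalFrom_singleton]

/-- An unsafe pair has an unsafe successor. Following such successors in a finite set must repeat a
pair, and the repeated pair, being unsafe, is critical. -/
theorem forall_safePair_of_noCriticalCycle [Finite σ] (h : A.NoCriticalCycle) (p q : σ) :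
    A.SafePair p q := by
  by_contra hpq
  have hstep : ∀ r : {r : σ × σ // ¬ A.SafePair r.1 r.2},
      ∃ a, ¬ A.SafePair (A.step r.1.1 a) (A.step r.1.2 a) := by
    intro r
    by_contra! hr
    exact r.2 (.step hr)
  choose next hnext using hstep
  let f : {r : σ × σ // ¬ A.SafePair r.1 r.2} → {r : σ × σ // ¬ A.SafePair r.1 r.2} :=
    fun r => ⟨(A.step r.1.1 (next r), A.step r.1.2 (next r)), hnext r⟩
  have hpath : ∀ (m : ℕ) r, ∃ x : List α, x.length = m ∧
      (f^[m] r).1 = (A.evalFrom r.1.1 x, A.evalFrom r.1.2 x) := by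
    intro m
    induction m with
    | zero => exact fun r => ⟨[], by simp⟩
    | succ m ih =>
      intro r
      obtain ⟨x, hx, hf⟩ := ih (f r)
      exact ⟨next r :: x, by simp [hx], by simpa [f] using hf⟩
  obtain ⟨i, j, hij, he⟩ := Finite.exists_ne_map_eq_of_infinite fun m => f^[m] ⟨(p, q), hpq⟩
  wlog hlt : i < j generalizing i j
  · exact this j i hij.symm he.symm (by omega)
  obtain ⟨d, rfl⟩ : ∃ d, j = d + i := ⟨j - i, by omega⟩
  obtain ⟨x, hx, hf⟩ := hpath d (f^[i] ⟨(p, q), hpq⟩)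
  simp only [Function.iterate_add_apply] at he
  rw [← he] at hf
  have hc : A.IsCritical (f^[i] ⟨(p, q), hpq⟩).1.1 (f^[i] ⟨(p, q), hpq⟩).1.2 := by
    by_contra hn
    exact (f^[i] ⟨(p, q), hpq⟩).2 (.base hn)
  refine h _ _ x hc ?_ (Prod.ext_iff.1 hf).1.symm (Prod.ext_iff.1 hf).2.symm
  rintro rfl
  simp at hx
  omega

theorem noCriticalCycle_of_isGeneralizedDefinite (h : A.accepts.IsGeneralizedDefinite) :
    A.NoCriticalCycle := by
  obtain ⟨m, hm⟩ := h
  -- The bound extends from length exactly `m` to length at least `m`: the surplus inner letters are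
  -- absorbed into the middle word.
  have hm' : ∀ x₁ x₂ y : List α, m ≤ x₁.length → m ≤ x₂.length →
      (x₁ ++ y ++ x₂ ∈ A.accepts ↔ x₁ ++ x₂ ∈ A.accepts) := by
    intro x₁ x₂ y h₁ h₂
    have e₁ := List.take_append_drop m x₁
    have e₂ := List.take_append_drop (x₂.length - m) x₂
    rw [← e₁, ← e₂]
    set a := x₁.take m with ha
    set b := x₁.drop m
    set c := x₂.take (x₂.length - m)
    set d := x₂.drop (x₂.length - m) with hd
    have la : a.length = m := by simp [ha, h₁]
    have ld : d.length = m := by simp [hd]; omega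
    have i₁ := hm a d (b ++ y ++ c) la ld
    have i₂ := hm a d (b ++ c) la ld
    simp only [List.append_assoc] at i₁ i₂ ⊢
    rw [i₁, i₂]
  rintro p q x ⟨⟨u, rfl⟩, ⟨y, rfl⟩, hne⟩ hx hp hq
  apply hne
  ext z
  have hpow : ∀ s, A.evalFrom s x = s → A.evalFrom s (List.replicate m x).flatten = s := by
    intro s hs
    rw [evalFrom_flatten_replicate]
    exact Function.iterate_fixed hs m
  have hlen : m ≤ (List.replicate m x).flatten.length := by
    simp
    exact Nat.le_mul_of_pos_right m (List.length_pos_iff.2 hx)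
  have := hm' (u ++ (List.replicate m x).flatten) ((List.replicate m x).flatten ++ z) y
    (by rw [List.length_append]; omega) (by rw [List.length_append]; omega)
  simp only [mem_accepts, eval_append, evalFrom_of_append, hpow _ hp, hpow _ hq] at this
  simp only [mem_acceptsFrom]
  exact this.symm

/-- With preperiod `i` and period `d` of the powers of `f`, the exponent `d * (i + 1)` is a positive
multiple of the period and at least `i`, so doubling it changes nothing. -/
theorem exists_iterate_idempotent {β : Type*} [Finite β] (f : β → β) :
    ∃ m, 0 < m ∧ ∀ b, f^[m] (f^[m] b) = f^[m] b := by
  obtain ⟨i, j, hij, he⟩ := Finite.exists_ne_map_eq_of_infinite fun m => f^[m]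
  wlog hlt : i < j generalizing i j
  · exact this j i hij.symm he.symm (by omega)
  obtain ⟨d, rfl⟩ : ∃ d, j = d + i := ⟨j - i, by omega⟩
  have hper : ∀ t m, i ≤ m → f^[m + d * t] = f^[m] := by
    intro t
    induction t with
    | zero => simp
    | succ t ih =>
      intro m hm
      obtain ⟨c, rfl⟩ : ∃ c, m = i + c := ⟨m - i, by omega⟩
      have := ih (i + c) hm
      calc f^[i + c + d * (t + 1)] = f^[(d + i) + (c + d * t)] := by congr 1; ring
        _ = f^[i + (c + d * t)] := by
          rw [Function.iterate_add, ← he, ← Function.iterate_add]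
        _ = _ := by rw [← this]; congr 1; ring
  have hd : 0 < d := by omega
  refine ⟨d * (i + 1), by positivity, fun b => ?_⟩
  rw [← Function.iterate_add_apply, hper (i + 1) (d * (i + 1)) (by nlinarith)]

/-- Pigeonhole on the transformations of the state set induced by the prefixes of `x`, of which
there are more than maps `σ → σ`. Comparing whole transformations makes the split independent of the
initial state, as the suffix requires. -/
theorem exists_split_of_card_le [Fintype σ] [DecidableEq σ] (x : List α)
    (hx : Fintype.card (σ → σ) ≤ x.length) :
    ∃ u v w, x = u ++ v ++ w ∧ v ≠ [] ∧ ∀ p, A.evalFrom p (u ++ v) = A.evalFrom p u := by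
  obtain ⟨i, j, hij, he⟩ := Fintype.exists_ne_map_eq_of_card_lt
    (fun (i : Fin (x.length + 1)) p => A.evalFrom p (x.take i)) (by simpa using hx)
  wlog hlt : i < j generalizing i j
  · exact this j i hij.symm he.symm (lt_of_le_of_ne (not_lt.1 hlt) hij.symm)
  have hlt' : (i : ℕ) < j := hlt
  have hj : (j : ℕ) ≤ x.length := by omega
  have e : x.take i ++ (x.take j).drop i = x.take j := by
    have := List.take_append_drop i (x.take j)
    rwa [List.take_take, min_eq_left hlt'.le] at this
  refine ⟨x.take i, (x.take j).drop i, x.drop j, ?_, ?_, fun p => ?_⟩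
  · rw [e, List.take_append_drop]
  · rw [← List.length_pos_iff]
    simp
    omega
  · rw [e]
    exact (congrFun he p).symm

theorem isGeneralizedDefinite_of_noCriticalCycle [Finite σ] (h : A.NoCriticalCycle) :
    A.accepts.IsGeneralizedDefinite := by
  classical
  have := Fintype.ofFinite σ
  -- Both `r·e` and `r·ete` are fixed by `e` and the second is reachable from the first, so
  -- inequivalence would give a critical cycle.
  have hidem : ∀ e t r, e ≠ [] → (∃ u, A.eval u = r) →
      (∀ p, A.evalFrom (A.evalFrom p e) e = A.evalFrom p e) →
      A.acceptsFrom (A.evalFrom r (e ++ t ++ e)) = A.acceptsFrom (A.evalFrom r e) := by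
    rintro e t r he ⟨u, hu⟩ hee
    by_contra hne
    refine h (A.evalFrom r e) (A.evalFrom r (e ++ t ++ e)) e
      ⟨⟨u ++ e, by rw [eval_append, hu]⟩, ⟨t ++ e, ?_⟩, fun h => hne h.symm⟩ he (hee _) ?_
    · simp [evalFrom_of_append]
    · simp [evalFrom_of_append, hee]
  have hpow : ∀ x : List α, x ≠ [] → ∃ e, e ≠ [] ∧ (∀ p, A.evalFrom p x = p → A.evalFrom p e = p) ∧
      ∀ p, A.evalFrom (A.evalFrom p e) e = A.evalFrom p e := by
    intro x hx
    obtain ⟨m, hm, hi⟩ := exists_iterate_idempotent fun s => A.evalFrom s x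
    refine ⟨(List.replicate m x).flatten, ?_, fun p hp => ?_, fun p => ?_⟩
    · simp [List.flatten_eq_nil_iff, hx]
      omega
    · rw [evalFrom_flatten_replicate]
      exact Function.iterate_fixed hp m
    · simp only [evalFrom_flatten_replicate, hi]
  refine ⟨Fintype.card (σ → σ), fun x₁ x₂ y h₁ h₂ => ?_⟩
  obtain ⟨u₁, v₁, w₁, rfl, hv₁, hp₁⟩ := A.exists_split_of_card_le x₁ h₁.ge
  obtain ⟨u₂, v₂, w₂, rfl, hv₂, hp₂⟩ := A.exists_split_of_card_le x₂ h₂.ge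
  obtain ⟨e, he, hfix, hee⟩ := hpow v₁ hv₁
  obtain ⟨f, hf, hfix', hff⟩ := hpow v₂ hv₂
  simp only [evalFrom_of_append] at hp₁ hp₂
  -- With `r` the state after `u₁`, which `e` fixes: `r·tf` is equivalent to `r·tfef` by idempotence
  -- of `f`, and `r·tfe` to `r` by idempotence of `e`. Reading `f` after the latter gives `r·tf ~
  -- r·f`.
  have key : ∀ t, A.acceptsFrom (A.evalFrom (A.eval u₁) (t ++ f)) =
      A.acceptsFrom (A.evalFrom (A.eval u₁) f) := by
    intro t
    have hr : A.evalFrom (A.eval u₁) e = A.eval u₁ := hfix _ (hp₁ _)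
    have k₁ := hidem f e (A.evalFrom (A.eval u₁) t) hf ⟨u₁ ++ t, A.eval_append _ _⟩ hff
    have k₂ := A.acceptsFrom_evalFrom_congr (hidem e (t ++ f) (A.eval u₁) he ⟨u₁, rfl⟩ hee) f
    simp only [evalFrom_of_append, hr] at k₁ k₂ ⊢
    rw [← k₁, k₂]
  have hfu : ∀ p, A.evalFrom (A.evalFrom p u₂) f = A.evalFrom p u₂ := fun p => hfix' _ (hp₂ p)
  have k := (key (w₁ ++ y ++ u₂)).trans (key (w₁ ++ u₂)).symm
  have := Set.ext_iff.1 k w₂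
  change w₂ ∈ A.acceptsFrom _ ↔ w₂ ∈ A.acceptsFrom _ at this
  simp only [mem_acceptsFrom, evalFrom_of_append, hfu] at this
  simp only [mem_accepts, eval_append, evalFrom_of_append, hp₂]
  rw [show A.evalFrom (A.eval u₁) v₁ = A.eval u₁ from hp₁ _]
  exact this

theorem isGeneralizedDefinite_accepts_iff [Finite σ] :
    A.accepts.IsGeneralizedDefinite ↔ ∀ p q, A.SafePair p q :=
  ⟨fun h => A.forall_safePair_of_noCriticalCycle (A.noCriticalCycle_of_isGeneralizedDefinite h),
    fun h => A.isGeneralizedDefinite_of_noCriticalCycle (A.noCriticalCycle_of_forall_safePair h)⟩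

end DFA

/-! ### Structured programs and their compilation -/

namespace RAM

/-- The state of a structured program: registers, arrays and elapsed time. -/
structure Store where
  reg : ℕ → ℕ
  arr : ℕ → ℕ → ℕ
  time : ℕ

/-- The number of arrays available to structured programs. -/
def width : ℕ := 16

/-- The basic operations of structured programs. -/
inductive Op where
  | const (d c : ℕ)
  | add (d a b : ℕ)
  | sub (d a b : ℕ)
  /-- `get d j i`: copy the entry of array `j` with index in register `i` to register `d`. -/
  | get (d j i : ℕ)
  /-- `put j i s`: copy register `s` to the entry of array `j` with index in register `i`. -/
  | put (j i s : ℕ)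
  /-- `input d i`: copy the input entry with index in register `i` to register `d`. -/
  | input (d i : ℕ)

/-- Structured programs. -/
inductive Cmd where
  | skip
  | op (o : Op)
  | seq (c d : Cmd)
  | ite (a b : ℕ) (c d : Cmd)
  | loop (a b : ℕ) (c : Cmd)

/-- The unit of time charged for a test in `ite` or `loop`. -/
def Store.tick (s : Store) : Store := ⟨s.reg, s.arr, s.time + 1⟩

/-- The effect of a basic operation. -/
def Op.run (inp : List ℕ) : Op → Store → Store
  | .const d c, s => ⟨Function.update s.reg d c, s.arr, s.time + 1⟩
  | .add d a b, s => ⟨Function.update s.reg d (s.reg a + s.reg b), s.arr, s.time + 1⟩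
  | .sub d a b, s => ⟨Function.update s.reg d (s.reg a - s.reg b), s.arr, s.time + 1⟩
  | .get d j i, s => ⟨Function.update s.reg d (s.arr j (s.reg i)), s.arr, s.time + 1⟩
  | .put j i r, s =>
    ⟨s.reg, Function.update s.arr j (Function.update (s.arr j) (s.reg i) (s.reg r)), s.time + 1⟩
  | .input d i, s => ⟨Function.update s.reg d (inp.getD (s.reg i) 0), s.arr, s.time + 1⟩

/-- A basic operation is valid if it names an existing array or an entry of the input. -/
def Op.Valid (inp : List ℕ) : Op → Store → Prop
  | .get _ j _, _ => j < width
  | .put j _ _, _ => j < width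
  | .input _ i, s => s.reg i < inp.length
  | _, _ => True

/-- Big-step semantics of structured programs. -/
inductive Exec (inp : List ℕ) : Cmd → Store → Store → Prop
  | skip {s} : Exec inp .skip s s
  | op {o s} : o.Valid inp s → Exec inp (.op o) s (o.run inp s)
  | seq {c d s t u} : Exec inp c s t → Exec inp d t u → Exec inp (.seq c d) s u
  | ite_true {a b c d s t} : s.reg a < s.reg b → Exec inp c s.tick t → Exec inp (.ite a b c d) s t
  | ite_false {a b c d s t} : ¬ s.reg a < s.reg b → Exec inp d s.tick t →
      Exec inp (.ite a b c d) s t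
  | loop_true {a b c s t u} : s.reg a < s.reg b → Exec inp c s.tick t →
      Exec inp (.loop a b c) t u → Exec inp (.loop a b c) s u
  | loop_false {a b c s} : ¬ s.reg a < s.reg b → Exec inp (.loop a b c) s s.tick

/-- Instructions computing the address of an array entry in register `0`; the base address is in
register `1`. -/
def addressCode (j i : ℕ) : List Instr :=
  .const 0 j :: .add 0 0 1 :: List.replicate width (.add 0 0 (i + 2))

/-- The instructions for a basic operation. -/
def Op.code : Op → List Instr
  | .const d c => [.const (d + 2) c]
  | .add d a b => [.add (d + 2) (a + 2) (b + 2)]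
  | .sub d a b => [.sub (d + 2) (a + 2) (b + 2)]
  | .get d j i => addressCode j i ++ [.load (d + 2) 0]
  | .put j i s => addressCode j i ++ [.store 0 (s + 2)]
  | .input d i => [.load (d + 2) (i + 2)]

/-- The length of the compiled program. -/
def Cmd.size : Cmd → ℕ
  | .skip => 0
  | .op o => o.code.length
  | .seq c d => c.size + d.size
  | .ite _ _ c d => c.size + d.size + 3
  | .loop _ _ c => c.size + 3

/-- The compiled program, to be placed at position `o`. -/
def Cmd.compile : Cmd → ℕ → List Instr
  | .skip, _ => []
  | .op p, _ => p.code
  | .seq c d, o => c.compile o ++ d.compile (o + c.size)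
  | .ite a b c d, o =>
    [.jumpLt (a + 2) (b + 2) (o + 2), .jump (o + c.size + 3)] ++ c.compile (o + 2) ++
      [.jump (o + c.size + d.size + 3)] ++ d.compile (o + c.size + 3)
  | .loop a b c, o =>
    [.jumpLt (a + 2) (b + 2) (o + 2), .jump (o + c.size + 3)] ++ c.compile (o + 2) ++ [.jump o]

@[simp]
theorem Cmd.length_compile (c : Cmd) (o : ℕ) : (c.compile o).length = c.size := by
  induction c generalizing o with
  | skip => rfl
  | op p => rfl
  | seq c d hc hd => simp [compile, size, hc, hd]
  | ite a b c d hc hd => simp [compile, size, hc, hd]; omega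
  | loop a b c hc => simp [compile, size, hc]

/-- The list of instructions `l` stands in the program `P` at position `o`. -/
def Program.HasCodeAt (P : Program) (o : ℕ) (l : List Instr) : Prop :=
  ∀ i (h : i < l.length), P[o + i]? = some l[i]

theorem Program.hasCodeAt_append {P : Program} {o : ℕ} {l m : List Instr} :
    P.HasCodeAt o (l ++ m) ↔ P.HasCodeAt o l ∧ P.HasCodeAt (o + l.length) m := by
  refine ⟨fun h => ⟨fun i hi => ?_, fun i hi => ?_⟩, fun ⟨h₁, h₂⟩ i hi => ?_⟩
  · rw [h i (by rw [List.length_append]; omega), List.getElem_append_left]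
  · rw [add_assoc, h (l.length + i) (by rw [List.length_append]; omega)]
    simp
  · rcases lt_or_ge i l.length with h | h
    · rw [List.getElem_append_left h, h₁ i h]
    · rw [List.length_append] at hi
      obtain ⟨c, rfl⟩ := Nat.exists_eq_add_of_le h
      rw [← add_assoc, h₂ c (by omega)]
      simp

theorem Program.hasCodeAt_cons {P : Program} {o : ℕ} {i : Instr} {l : List Instr} :
    P.HasCodeAt o (i :: l) ↔ P[o]? = some i ∧ P.HasCodeAt (o + 1) l := by
  rw [← List.singleton_append, hasCodeAt_append]
  simp [HasCodeAt]

theorem Program.hasCodeAt_self_append (l m r : List Instr) :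
    Program.HasCodeAt (l ++ m ++ r) l.length m := by
  intro i hi
  rw [List.getElem?_append_left (by simp [hi]), List.getElem?_append_right (by simp)]
  simp [hi]

/-- An instruction that is neither a jump nor a halt instruction. -/
def Instr.IsBasic : Instr → Prop
  | .jump _ => False
  | .jumpLt _ _ _ => False
  | .halt _ => False
  | _ => True

theorem Program.iterate_step_of_isBasic {P : Program} (l : List Instr) {σ : Config}
    (hl : ∀ i ∈ l, i.IsBasic) (h : P.HasCodeAt σ.pc l) :
    P.step^[l.length] σ = l.foldl (fun s i => i.exec s) σ ∧
      (l.foldl (fun s i => i.exec s) σ).pc = σ.pc + l.length := by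
  induction l generalizing σ with
  | nil => simp
  | cons i l ih =>
    rw [hasCodeAt_cons] at h
    have hi : (i.exec σ).pc = σ.pc + 1 := by
      have := hl i (by simp)
      cases i <;> first | rfl | exact this.elim
    have hs : P.step σ = i.exec σ := by simp [step, h.1]
    have := ih (σ := i.exec σ) (fun j hj => hl j (by simp [hj])) (by rw [hi]; exact h.2)
    simp only [List.length_cons, Function.iterate_succ_apply, List.foldl_cons, hs]
    exact ⟨this.1, by rw [this.2, hi]; omega⟩

/-- The configuration `σ` represents the store `s`; the arrays stand interleaved in memory from
address `B` on, above the input. -/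
structure Represents (inp : List ℕ) (B : ℕ) (s : Store) (σ : Config) : Prop where
  base : σ.reg 1 = B
  le : inp.length ≤ B
  reg : ∀ r, σ.reg (r + 2) = s.reg r
  arr : ∀ j i, j < width → σ.mem (B + width * i + j) = s.arr j i
  input : ∀ i < inp.length, σ.mem i = inp.getD i 0

/-- There is no multiplication instruction, so `width * i` is a `width`-fold addition; since `width`
is fixed, an array access still has constant cost. -/
theorem foldl_addressCode (j i : ℕ) (σ : Config) :
    (addressCode j i).foldl (fun s i => i.exec s) σ =
      ⟨σ.pc + (addressCode j i).length,
        Function.update σ.reg 0 (σ.reg 1 + width * σ.reg (i + 2) + j), σ.mem⟩ := by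
  have h : ∀ (m : ℕ) (σ : Config), (List.replicate m (Instr.add 0 0 (i + 2))).foldl
      (fun s i => i.exec s) σ =
        ⟨σ.pc + m, Function.update σ.reg 0 (σ.reg 0 + m * σ.reg (i + 2)), σ.mem⟩ := by
    intro m
    induction m with
    | zero => intro σ; simp
    | succ m ih =>
      intro σ
      rw [List.replicate_succ, List.foldl_cons, ih]
      simp only [Instr.exec, Config.mk.injEq, Function.update_self, Function.update_idem, and_true]
      refine ⟨by omega, ?_⟩
      rw [Function.update_of_ne (by omega)]
      congr 1
      ring
  rw [addressCode, List.foldl_cons, List.foldl_cons, h]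
  simp only [Instr.exec, Config.mk.injEq, Function.update_self, Function.update_idem, and_true,
    List.length_cons, List.length_replicate]
  refine ⟨by omega, ?_⟩
  simp only [ne_eq, Nat.add_eq_zero_iff, OfNat.ofNat_ne_zero, one_ne_zero, and_false,
    not_false_eq_true, Function.update_of_ne]
  congr 1
  ring

theorem Op.isBasic_of_mem_code {o : Op} {i : Instr} (h : i ∈ o.code) : i.IsBasic := by
  cases o <;> simp only [code, addressCode, List.mem_append, List.mem_cons, List.mem_replicate,
    List.not_mem_nil, or_false] at h
  case get | put => obtain (rfl | rfl | ⟨-, rfl⟩) | rfl := h <;> trivial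
  all_goals subst h; trivial

/-- The longest code is an array access with 19 instructions; the bound becomes the slowdown factor
in `Exec.simulate`. -/
theorem Op.length_code_le (o : Op) : o.code.length ≤ 20 := by
  cases o <;> simp [code, addressCode, width]

theorem Represents.update_reg {inp : List ℕ} {B : ℕ} {s : Store} {σ : Config}
    (h : Represents inp B s σ) {ρ : ℕ → ℕ} (h₁ : ρ 1 = σ.reg 1)
    (h₂ : ∀ r, ρ (r + 2) = σ.reg (r + 2)) (d x p t : ℕ) :
    Represents inp B ⟨Function.update s.reg d x, s.arr, t⟩
      ⟨p, Function.update ρ (d + 2) x, σ.mem⟩ where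
  base := by
    change Function.update ρ (d + 2) x 1 = B
    rw [Function.update_of_ne (by omega), h₁, h.base]
  le := h.le
  reg r := by
    simp only [Function.update_apply, Nat.add_right_cancel_iff]
    split_ifs
    · rfl
    · rw [h₂, h.reg]
  arr := h.arr
  input := h.input

theorem Op.represents_foldl {inp : List ℕ} {B : ℕ} {s : Store} {σ : Config} (o : Op)
    (hv : o.Valid inp s) (h : Represents inp B s σ) :
    Represents inp B (o.run inp s) (o.code.foldl (fun s i => i.exec s) σ) := by
  cases o with
  | const d c => exact h.update_reg rfl (fun _ => rfl) _ _ _ _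
  | add d a b =>
    simp only [code, List.foldl_cons, List.foldl_nil, Instr.exec, h.reg]
    exact h.update_reg rfl (fun _ => rfl) _ _ _ _
  | sub d a b =>
    simp only [code, List.foldl_cons, List.foldl_nil, Instr.exec, h.reg]
    exact h.update_reg rfl (fun _ => rfl) _ _ _ _
  | input d i =>
    simp only [code, List.foldl_cons, List.foldl_nil, Instr.exec, h.reg]
    rw [h.input _ hv]
    exact h.update_reg rfl (fun _ => rfl) _ _ _ _
  | get d j i =>
    simp only [code, List.foldl_append, foldl_addressCode]
    simp only [List.foldl_cons, List.foldl_nil, Instr.exec, Function.update_self, h.reg, h.base]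
    rw [h.arr _ _ hv]
    refine h.update_reg ?_ (fun r => ?_) _ _ _ _
    · rw [Function.update_of_ne (by omega)]
    · rw [Function.update_of_ne (by omega)]
  | put j i r =>
    simp only [code, List.foldl_append, foldl_addressCode]
    simp only [List.foldl_cons, List.foldl_nil, Instr.exec, Function.update_self, h.reg, h.base]
    rw [Function.update_of_ne (by omega), h.reg]
    have hj : j < width := hv
    refine ⟨?_, h.le, fun r => ?_, fun j' i' hj' => ?_, fun m hm => ?_⟩
    · simp only
      rw [Function.update_of_ne (by omega), h.base]
    · simp only [run]
      rw [Function.update_of_ne (by omega), h.reg]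
    · simp only [run, Function.update_apply]
      -- Interleaving is injective because `j` and `j'` are remainders modulo `width`, so a write
      -- changes exactly one array entry.
      have : B + width * i' + j' = B + width * s.reg i + j ↔ j' = j ∧ i' = s.reg i := by
        unfold width at *
        omega
      simp only [this]
      by_cases e : j' = j
      · subst e
        by_cases e' : i' = s.reg i
        · simp [e']
        · simp only [e', and_false, if_false, if_true, Function.update_apply]
          rw [h.arr _ _ hj]
      · simp [e, h.arr _ _ hj']
    · simp only
      have := h.le
      rw [Function.update_of_ne (by omega), h.input m hm]

theorem Represents.congr {inp : List ℕ} {B : ℕ} {s s' : Store} {σ σ' : Config}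
    (h : Represents inp B s σ) (hr : s'.reg = s.reg) (ha : s'.arr = s.arr)
    (hr' : σ'.reg = σ.reg) (hm : σ'.mem = σ.mem) : Represents inp B s' σ' := by
  refine ⟨?_, h.le, ?_, ?_, ?_⟩
  · rw [hr', h.base]
  · rw [hr', hr]; exact h.reg
  · rw [hm, ha]; exact h.arr
  · rw [hm]; exact h.input

theorem Program.step_of_jump {P : Program} {σ : Config} {l : ℕ} (h : P[σ.pc]? = some (.jump l)) :
    P.step σ = ⟨l, σ.reg, σ.mem⟩ := by
  simp [step, h, Instr.exec]

theorem Program.HasCodeAt.ite {P : Program} {a b o : ℕ} {c d : Cmd}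
    (h : P.HasCodeAt o ((Cmd.ite a b c d).compile o)) :
    P[o]? = some (.jumpLt (a + 2) (b + 2) (o + 2)) ∧ P[o + 1]? = some (.jump (o + c.size + 3)) ∧
      P.HasCodeAt (o + 2) (c.compile (o + 2)) ∧
      P[o + c.size + 2]? = some (.jump (o + c.size + d.size + 3)) ∧
      P.HasCodeAt (o + c.size + 3) (d.compile (o + c.size + 3)) := by
  simp only [Cmd.compile, hasCodeAt_append, hasCodeAt_cons, Cmd.length_compile,
    List.length_append, List.length_cons, List.length_nil, List.cons_append, List.nil_append] at h
  refine ⟨h.1, h.2.1, h.2.2.1.1, ?_, ?_⟩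
  · rw [← h.2.2.1.2.1]
    congr 1
    omega
  · convert h.2.2.2 using 1
    omega

theorem Program.HasCodeAt.loop {P : Program} {a b o : ℕ} {c : Cmd}
    (h : P.HasCodeAt o ((Cmd.loop a b c).compile o)) :
    P[o]? = some (.jumpLt (a + 2) (b + 2) (o + 2)) ∧ P[o + 1]? = some (.jump (o + c.size + 3)) ∧
      P.HasCodeAt (o + 2) (c.compile (o + 2)) ∧ P[o + c.size + 2]? = some (.jump o) := by
  simp only [Cmd.compile, hasCodeAt_append, hasCodeAt_cons, Cmd.length_compile,
    List.cons_append, List.nil_append] at h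
  refine ⟨h.1, h.2.1, h.2.2.1, ?_⟩
  rw [← h.2.2.2.1]
  congr 1
  omega

/-- Compiled programs simulate structured programs, with a constant slowdown. -/
theorem Exec.simulate {inp : List ℕ} {B : ℕ} {P : Program} {c : Cmd} {s s' : Store}
    (h : Exec inp c s s') : ∀ {σ : Config}, P.HasCodeAt σ.pc (c.compile σ.pc) →
      Represents inp B s σ → ∃ t, t + 20 * s.time ≤ 20 * s'.time ∧
        (P.step^[t] σ).pc = σ.pc + c.size ∧ Represents inp B s' (P.step^[t] σ) := by
  induction h with
  | skip => exact fun _ h => ⟨0, by omega, rfl, h⟩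
  | @op o s hv =>
    intro σ hc h
    obtain ⟨h₁, h₂⟩ := Program.iterate_step_of_isBasic _ (fun _ => Op.isBasic_of_mem_code) hc
    refine ⟨o.code.length, ?_, ?_, ?_⟩
    · have := o.length_code_le
      have : (o.run inp s).time = s.time + 1 := by cases o <;> rfl
      omega
    · exact (congrArg Config.pc h₁).trans h₂
    · have h₁' : P.step^[o.code.length] σ = _ := h₁
      rw [h₁']
      exact o.represents_foldl hv h
  | seq _ _ ih₁ ih₂ =>
    intro σ hc h
    obtain ⟨hc₁, hc₂⟩ := Program.hasCodeAt_append.1 hc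
    rw [Cmd.length_compile] at hc₂
    obtain ⟨t₁, ht₁, hp₁, hr₁⟩ := ih₁ hc₁ h
    obtain ⟨t₂, ht₂, hp₂, hr₂⟩ := ih₂ (hp₁ ▸ hc₂) hr₁
    refine ⟨t₂ + t₁, by omega, ?_, ?_⟩
    · rw [Function.iterate_add_apply, hp₂, hp₁, Cmd.size, add_assoc]
    · rw [Function.iterate_add_apply]
      exact hr₂
  | @ite_true a b c d s s' hlt _ ih =>
    intro σ hc h
    obtain ⟨h₀, -, h₂, h₃, -⟩ := hc.ite
    have hs : P.step σ = ⟨σ.pc + 2, σ.reg, σ.mem⟩ := by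
      simp [Program.step, h₀, Instr.exec, h.reg, hlt]
    obtain ⟨t, ht, hp, hr⟩ := ih (σ := ⟨σ.pc + 2, σ.reg, σ.mem⟩) h₂ (h.congr rfl rfl rfl rfl)
    rw [← hs] at hp hr
    rw [← Function.iterate_succ_apply] at hp hr
    have hs' : P.step (P.step^[t + 1] σ) =
        ⟨σ.pc + c.size + d.size + 3, (P.step^[t + 1] σ).reg, (P.step^[t + 1] σ).mem⟩ := by
      have hp' : (P.step^[t + 1] σ).pc = σ.pc + c.size + 2 := by
        rw [hp, hs]
        dsimp only
        omega
      exact Program.step_of_jump (by rw [hp', h₃])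
    refine ⟨t + 1 + 1, ?_, ?_, ?_⟩
    · simp only [Store.tick] at ht
      omega
    · rw [Function.iterate_succ_apply', hs', Cmd.size]
      dsimp only
      omega
    · rw [Function.iterate_succ_apply', hs']
      exact hr.congr rfl rfl rfl rfl
  | @ite_false a b c d s s' hlt _ ih =>
    intro σ hc h
    obtain ⟨h₀, h₁, -, -, h₄⟩ := hc.ite
    have hs : P.step (P.step σ) = ⟨σ.pc + c.size + 3, σ.reg, σ.mem⟩ := by
      simp [Program.step, h₀, h₁, Instr.exec, h.reg, hlt]
    obtain ⟨t, ht, hp, hr⟩ := ih (σ := ⟨σ.pc + c.size + 3, σ.reg, σ.mem⟩) h₄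
      (h.congr rfl rfl rfl rfl)
    rw [← hs, ← Function.iterate_succ_apply, ← Function.iterate_succ_apply] at hp hr
    refine ⟨t + 1 + 1, ?_, ?_, hr⟩
    · simp only [Store.tick] at ht
      omega
    · rw [hp, hs, Cmd.size]
      simp only
      omega
  | @loop_true a b c s s' s'' hlt _ _ ih ih' =>
    intro σ hc h
    obtain ⟨h₀, -, h₂, h₃⟩ := hc.loop
    have hs : P.step σ = ⟨σ.pc + 2, σ.reg, σ.mem⟩ := by
      simp [Program.step, h₀, Instr.exec, h.reg, hlt]
    obtain ⟨t, ht, hp, hr⟩ := ih (σ := ⟨σ.pc + 2, σ.reg, σ.mem⟩) h₂ (h.congr rfl rfl rfl rfl)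
    rw [← hs] at hp hr
    rw [← Function.iterate_succ_apply] at hp hr
    have hs' : P.step (P.step^[t + 1] σ) =
        ⟨σ.pc, (P.step^[t + 1] σ).reg, (P.step^[t + 1] σ).mem⟩ := by
      have hp' : (P.step^[t + 1] σ).pc = σ.pc + c.size + 2 := by
        rw [hp, hs]
        dsimp only
        omega
      exact Program.step_of_jump (by rw [hp', h₃])
    obtain ⟨t', ht', hp', hr'⟩ := ih' (σ := P.step (P.step^[t + 1] σ)) (by rw [hs']; exact hc)
      (by rw [hs']; exact hr.congr rfl rfl rfl rfl)
    rw [← Function.iterate_succ_apply' P.step, ← Function.iterate_add_apply] at hp' hr'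
    refine ⟨t' + (t + 1 + 1), ?_, ?_, hr'⟩
    · simp only [Store.tick] at ht
      omega
    · rw [hp', Function.iterate_succ_apply', hs']
  | @loop_false a b c s hlt =>
    intro σ hc h
    obtain ⟨h₀, h₁, -, -⟩ := hc.loop
    have hs : P.step (P.step σ) = ⟨σ.pc + c.size + 3, σ.reg, σ.mem⟩ := by
      simp [Program.step, h₀, h₁, Instr.exec, h.reg, hlt]
    refine ⟨2, ?_, ?_, ?_⟩
    · simp only [Store.tick]
      omega
    · simp [hs, Cmd.size, add_assoc]
    · simp only [Function.iterate_succ, Function.comp, Function.iterate_zero, id, hs]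
      exact h.congr rfl rfl rfl rfl

end RAM

/-! ### Proof rules for total correctness with time bounds -/

namespace RAM

/-- Sequential composition of a list of commands. -/
def Cmd.block : List Cmd → Cmd
  | [] => .skip
  | c :: l => .seq c (block l)

/-- The loop in which register `i` runs through the numbers below register `b`; register `2` is
assumed to hold `1`. -/
def Cmd.forLt (i b : ℕ) (c : Cmd) : Cmd :=
  .seq (.op (.const i 0)) (.loop i b (.seq c (.op (.add i i 2))))

/-- The registers a command may write to. -/
def Cmd.regs : Cmd → List ℕ
  | .skip => []
  | .op (.const d _) => [d]
  | .op (.add d _ _) => [d]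
  | .op (.sub d _ _) => [d]
  | .op (.get d _ _) => [d]
  | .op (.input d _) => [d]
  | .op (.put _ _ _) => []
  | .seq c d => c.regs ++ d.regs
  | .ite _ _ c d => c.regs ++ d.regs
  | .loop _ _ c => c.regs

/-- The arrays a command may write to. -/
def Cmd.arrs : Cmd → List ℕ
  | .skip => []
  | .op (.put j _ _) => [j]
  | .op _ => []
  | .seq c d => c.arrs ++ d.arrs
  | .ite _ _ c d => c.arrs ++ d.arrs
  | .loop _ _ c => c.arrs

/-- The stores `s` and `s'` agree outside the registers `R` and the arrays `A`. -/
structure Agree (R A : List ℕ) (s s' : Store) : Prop where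
  reg : ∀ r ∉ R, s'.reg r = s.reg r
  arr : ∀ j ∉ A, s'.arr j = s.arr j

theorem Agree.refl (R A : List ℕ) (s : Store) : Agree R A s s := ⟨fun _ _ => rfl, fun _ _ => rfl⟩

theorem Agree.trans {R A : List ℕ} {s t u : Store} (h : Agree R A s t) (h' : Agree R A t u) :
    Agree R A s u :=
  ⟨fun r hr => (h'.reg r hr).trans (h.reg r hr), fun j hj => (h'.arr j hj).trans (h.arr j hj)⟩

theorem Agree.mono {R A R' A' : List ℕ} {s t : Store} (h : Agree R A s t) (hR : R ⊆ R')
    (hA : A ⊆ A') : Agree R' A' s t :=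
  ⟨fun r hr => h.reg r fun h => hr (hR h), fun j hj => h.arr j fun h => hj (hA h)⟩

/-- The frame property: whatever is not syntactically written is preserved, so postconditions and
invariants only mention what changes. -/
theorem Exec.agree {inp : List ℕ} {c : Cmd} {s t : Store} (h : Exec inp c s t) :
    Agree c.regs c.arrs s t := by
  induction h with
  | skip => exact .refl _ _ _
  | @op o s =>
    cases o <;> refine ⟨fun r hr => ?_, fun j hj => ?_⟩ <;>
      first
        | rfl
        | exact Function.update_of_ne (by simpa [Cmd.regs] using hr) _ _
        | exact Function.update_of_ne (by simpa [Cmd.arrs] using hj) _ _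
  | seq _ _ h₁ h₂ =>
    exact (h₁.mono (by simp [Cmd.regs]) (by simp [Cmd.arrs])).trans
      (h₂.mono (by simp [Cmd.regs]) (by simp [Cmd.arrs]))
  | ite_true _ _ h => exact Agree.mono ⟨h.reg, h.arr⟩ (List.subset_append_left _ _) (List.subset_append_left _ _)
  | ite_false _ _ h => exact Agree.mono ⟨h.reg, h.arr⟩ (List.subset_append_right _ _) (List.subset_append_right _ _)
  | loop_true _ _ _ h₁ h₂ => exact Agree.trans ⟨h₁.reg, h₁.arr⟩ h₂
  | loop_false => exact ⟨fun _ _ => rfl, fun _ _ => rfl⟩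

/-- From the store `s`, the command `c` terminates in a store satisfying `Q`. -/
def wp (inp : List ℕ) (c : Cmd) (Q : Store → Prop) (s : Store) : Prop :=
  ∃ t, Exec inp c s t ∧ Q t

section

variable {inp : List ℕ} {c d : Cmd} {Q Q' : Store → Prop} {s : Store} {a b : ℕ}

/-- The consequence rule, with the frame property available when the new postcondition is proved. -/
theorem wp.mono (h : wp inp c Q s) (hQ : ∀ t, Agree c.regs c.arrs s t → Q t → Q' t) :
    wp inp c Q' s := by
  obtain ⟨t, ht, hq⟩ := h
  exact ⟨t, ht, hQ t ht.agree hq⟩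

theorem wp_skip : wp inp .skip Q s ↔ Q s :=
  ⟨fun ⟨_, h, hq⟩ => by cases h; exact hq, fun h => ⟨s, .skip, h⟩⟩

theorem wp_op {o : Op} : wp inp (.op o) Q s ↔ o.Valid inp s ∧ Q (o.run inp s) :=
  ⟨fun ⟨_, h, hq⟩ => by cases h; exact ⟨‹_›, hq⟩, fun h => ⟨_, .op h.1, h.2⟩⟩

theorem wp_seq : wp inp (.seq c d) Q s ↔ wp inp c (wp inp d Q) s :=
  ⟨fun ⟨_, h, hq⟩ => by cases h with | seq h₁ h₂ => exact ⟨_, h₁, _, h₂, hq⟩,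
    fun ⟨_, h₁, _, h₂, hq⟩ => ⟨_, .seq h₁ h₂, hq⟩⟩

theorem wp_ite : wp inp (.ite a b c d) Q s ↔
    if s.reg a < s.reg b then wp inp c Q s.tick else wp inp d Q s.tick := by
  split_ifs with hlt
  · refine ⟨fun ⟨_, h, hq⟩ => ?_, fun ⟨_, h, hq⟩ => ⟨_, .ite_true hlt h, hq⟩⟩
    cases h with
    | ite_true _ h => exact ⟨_, h, hq⟩
    | ite_false h => exact absurd hlt h
  · refine ⟨fun ⟨_, h, hq⟩ => ?_, fun ⟨_, h, hq⟩ => ⟨_, .ite_false hlt h, hq⟩⟩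
    cases h with
    | ite_true h => exact absurd h hlt
    | ite_false _ h => exact ⟨_, h, hq⟩

theorem wp_loop_true (h : s.reg a < s.reg b) (hc : wp inp c (wp inp (.loop a b c) Q) s.tick) :
    wp inp (.loop a b c) Q s := by
  obtain ⟨_, h₁, _, h₂, hq⟩ := hc
  exact ⟨_, .loop_true h h₁ h₂, hq⟩

theorem wp_loop_false (h : ¬ s.reg a < s.reg b) (hq : Q s.tick) : wp inp (.loop a b c) Q s :=
  ⟨_, .loop_false h, hq⟩

theorem wp_block_nil : wp inp (.block []) Q s ↔ Q s := wp_skip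

theorem wp_block_cons {l : List Cmd} :
    wp inp (.block (c :: l)) Q s ↔ wp inp c (wp inp (.block l) Q) s := wp_seq

/-- The rule for `forLt` loops with an invariant `I` and a time bound `T` for the body. -/
theorem wp_forLt {i : ℕ} (I : ℕ → Store → Prop) (T : ℕ) (hi : i ∉ c.regs) (hb : b ∉ c.regs)
    (hbi : b ≠ i) (h2 : 2 ∉ c.regs) (h2i : 2 ≠ i) (hone : s.reg 2 = 1)
    (hI : ∀ x t v τ, I x t → I x ⟨Function.update t.reg i v, t.arr, τ⟩) (h0 : I 0 s)
    (hstep : ∀ x t, x < s.reg b → I x t → t.reg i = x → Agree (i :: c.regs) c.arrs s t →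
      wp inp c (fun t' => I (x + 1) t' ∧ t'.time ≤ t.time + T) t) :
    wp inp (.forLt i b c)
      (fun t => I (s.reg b) t ∧ t.time ≤ s.time + 2 + s.reg b * (T + 2)) s := by
  -- Induction on the number `m` of remaining rounds. A round costs `T` plus the test and the
  -- increment; the final failing test adds one, and the initialisation of `i` later adds another.
  have key : ∀ m x t, x + m = s.reg b → I x t → t.reg i = x → Agree (i :: c.regs) c.arrs s t →
      wp inp (.loop i b (.seq c (.op (.add i i 2))))
        (fun t' => I (s.reg b) t' ∧ t'.time ≤ t.time + 1 + m * (T + 2)) t := by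
    intro m
    induction m with
    | zero =>
      intro x t hx hIt ht hA
      have htb : t.reg b = s.reg b := hA.reg b (by simp [hb, hbi])
      refine wp_loop_false (by omega) ⟨?_, by simp [Store.tick]⟩
      rw [← hx]
      simpa [Store.tick] using hI x t (t.reg i) (t.time + 1) hIt
    | succ m ih =>
      intro x t hx hIt ht hA
      have htb : t.reg b = s.reg b := hA.reg b (by simp [hb, hbi])
      refine wp_loop_true (by omega) ?_
      rw [wp_seq]
      have hIt' : I x t.tick := by simpa [Store.tick] using hI x t (t.reg i) (t.time + 1) hIt
      have hA' : Agree (i :: c.regs) c.arrs s t.tick := ⟨hA.reg, hA.arr⟩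
      refine (hstep x t.tick (by omega) hIt' ht hA').mono ?_
      rintro u hu ⟨hIu, htu⟩
      rw [wp_op]
      refine ⟨trivial, ?_⟩
      have hui : u.reg i = x := (hu.reg i hi).trans ht
      have hAu : Agree (i :: c.regs) c.arrs s u :=
        hA'.trans (hu.mono (by simp) (List.Subset.refl _))
      have hu2 : u.reg 2 = 1 := by rw [hAu.reg 2 (by simp [h2, h2i]), hone]
      simp only [Op.run]
      refine (ih (x + 1) _ (by omega) (hI _ _ _ _ hIu) ?_ ?_).mono ?_
      · simp [hui, hu2]
      · refine hAu.trans ⟨fun r hr => ?_, fun _ _ => rfl⟩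
        exact Function.update_of_ne (by simp at hr; exact hr.1) _ _
      · rintro w - ⟨hw, htw⟩
        refine ⟨hw, ?_⟩
        simp only [Store.tick] at htu htw ⊢
        have : (m + 1) * (T + 2) = m * (T + 2) + (T + 2) := by ring
        omega
  rw [Cmd.forLt, wp_seq, wp_op]
  refine ⟨trivial, ?_⟩
  refine (key _ 0 _ (zero_add _) (hI _ _ _ _ h0) (by simp) ?_).mono ?_
  · exact ⟨fun r hr => Function.update_of_ne (by simp at hr; exact hr.1) _ _, fun _ _ => rfl⟩
  · rintro w - ⟨hw, htw⟩
    exact ⟨hw, by omega⟩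

end

end RAM

/-! ### Input format and arithmetical tables -/

namespace RAM

/-- The entry of the transition table for state `p` and letter `a`. -/
def tableEntry (inp : List ℕ) (n k p a : ℕ) : ℕ := inp.getD (n + 3 + k * p + a) 0

/-- The list `inp` has the shape of the representation of an automaton with `n` states and `k`
letters. -/
structure IsInput (inp : List ℕ) (n k : ℕ) : Prop where
  length : inp.length = n + 3 + n * k
  states : inp.getD 0 0 = n
  letters : inp.getD 1 0 = k
  start : inp.getD 2 0 < n
  table : ∀ p < n, ∀ a < k, tableEntry inp n k p a < n

/-- The registers `0` to `6` and the arrays `0` to `3` hold the constants and arithmetical tables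
used throughout the program. -/
structure Env (inp : List ℕ) (n k : ℕ) (s : Store) : Prop where
  states : s.reg 0 = n
  letters : s.reg 1 = k
  one : s.reg 2 = 1
  zero : s.reg 3 = 0
  start : s.reg 4 = inp.getD 2 0
  offset : s.reg 5 = n + 3
  pairs : s.reg 6 = n * n
  div : ∀ v < n * n, s.arr 0 v = v / n
  mod : ∀ v < n * n, s.arr 1 v = v % n
  mulStates : ∀ p < n, s.arr 2 p = n * p
  mulLetters : ∀ p < n, s.arr 3 p = k * p

theorem Env.of_agree {inp : List ℕ} {n k : ℕ} {s t : Store} {R A : List ℕ} (h : Env inp n k s)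
    (ha : Agree R A s t) (hR : ∀ r ∈ R, 7 ≤ r) (hA : ∀ j ∈ A, 4 ≤ j) : Env inp n k t := by
  have hr : ∀ r < 7, t.reg r = s.reg r := fun r hr => ha.reg r fun h => by
    have := hR r h
    omega
  have hj : ∀ j < 4, t.arr j = s.arr j := fun j hj => ha.arr j fun h => by
    have := hA j h
    omega
  constructor
  · rw [hr 0 (by omega), h.states]
  · rw [hr 1 (by omega), h.letters]
  · rw [hr 2 (by omega), h.one]
  · rw [hr 3 (by omega), h.zero]
  · rw [hr 4 (by omega), h.start]
  · rw [hr 5 (by omega), h.offset]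
  · rw [hr 6 (by omega), h.pairs]
  · rw [hj 0 (by omega)]; exact h.div
  · rw [hj 1 (by omega)]; exact h.mod
  · rw [hj 2 (by omega)]; exact h.mulStates
  · rw [hj 3 (by omega)]; exact h.mulLetters

/-- Reading the parameters and tabulating multiplication, division and remainder. -/
def setupCmd : Cmd := .block [
  .op (.const 3 0), .op (.const 2 1), .op (.input 0 3), .op (.input 1 2), .op (.add 4 2 2),
  .op (.input 4 4), .op (.const 5 3), .op (.add 5 0 5), .op (.const 8 0), .op (.const 9 0),
  .forLt 7 0 (.block [.op (.put 2 7 8), .op (.put 3 7 9), .op (.add 8 8 0), .op (.add 9 9 1)]),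
  .op (.const 7 0),
  .forLt 8 0 (.forLt 9 0 (.block [.op (.put 0 7 8), .op (.put 1 7 9), .op (.add 7 7 2)])),
  .op (.add 6 7 3)]

/-- Registers `8` and `9` carry the current multiples of the contents of registers `0` and `1`, so
the products are tabulated by additions alone. -/
theorem wp_mulTables {inp : List ℕ} {s : Store} (h2 : s.reg 2 = 1) (h8 : s.reg 8 = 0)
    (h9 : s.reg 9 = 0) :
    wp inp (.forLt 7 0 (.block [.op (.put 2 7 8), .op (.put 3 7 9), .op (.add 8 8 0),
      .op (.add 9 9 1)]))
      (fun t => (∀ p < s.reg 0, t.arr 2 p = s.reg 0 * p ∧ t.arr 3 p = s.reg 1 * p) ∧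
        t.time ≤ s.time + 2 + s.reg 0 * 6) s := by
  refine (wp_forLt (fun x t => t.reg 8 = s.reg 0 * x ∧ t.reg 9 = s.reg 1 * x ∧
    ∀ p < x, t.arr 2 p = s.reg 0 * p ∧ t.arr 3 p = s.reg 1 * p) 4 (by decide) (by decide)
    (by decide) (by decide) (by decide) h2 ?_ ?_ ?_).mono ?_
  · intro x t v τ h
    simpa using h
  · simp [h8, h9]
  · rintro x t hx ⟨h8, h9, hp⟩ h7 hA
    have h0 : t.reg 0 = s.reg 0 := hA.reg 0 (by decide)
    have h1 : t.reg 1 = s.reg 1 := hA.reg 1 (by decide)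
    simp only [wp_block_cons, wp_block_nil, wp_op, Op.Valid, width, Op.run, Nat.reduceLT, true_and,
      Function.update_apply, Nat.reduceEqDiff, if_true, if_false, h7, h8, h9, h0, h1]
    refine ⟨⟨by ring, by ring, fun p hp' => ?_⟩, by omega⟩
    by_cases e : p = x
    · simp [e]
    · simp [e, hp p (by omega)]
  · rintro t - ⟨⟨-, -, h⟩, ht⟩
    exact ⟨h, by omega⟩

/-- Register `7` enumerates the pairs lexicographically and equals `n * x + y` at outer index `x`
and inner index `y`, where `n` is the content of register `0`; quotient and remainder are thus the
loop indices themselves. -/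
theorem wp_pairTables {inp : List ℕ} {s : Store} (h2 : s.reg 2 = 1) (h7 : s.reg 7 = 0) :
    wp inp (.forLt 8 0 (.forLt 9 0 (.block [.op (.put 0 7 8), .op (.put 1 7 9),
      .op (.add 7 7 2)])))
      (fun t => t.reg 7 = s.reg 0 * s.reg 0 ∧
        (∀ v < s.reg 0 * s.reg 0, t.arr 0 v = v / s.reg 0 ∧ t.arr 1 v = v % s.reg 0) ∧
        t.time ≤ s.time + 2 + s.reg 0 * (4 + s.reg 0 * 5)) s := by
  refine (wp_forLt (fun x t => t.reg 7 = s.reg 0 * x ∧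
    ∀ v < s.reg 0 * x, t.arr 0 v = v / s.reg 0 ∧ t.arr 1 v = v % s.reg 0) (2 + s.reg 0 * 5)
    (by decide) (by decide) (by decide) (by decide) (by decide) h2 ?_ ?_ ?_).mono ?_
  · intro x t v τ h
    simpa using h
  · simp [h7]
  · rintro x t hx ⟨h7, hv⟩ h8 hA
    have h0 : t.reg 0 = s.reg 0 := hA.reg 0 (by decide)
    refine (wp_forLt (fun y t => t.reg 7 = s.reg 0 * x + y ∧
      ∀ v < s.reg 0 * x + y, t.arr 0 v = v / s.reg 0 ∧ t.arr 1 v = v % s.reg 0) 3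
      (by decide) (by decide) (by decide) (by decide) (by decide) ?_ ?_ ⟨h7, hv⟩ ?_).mono ?_
    · rw [hA.reg 2 (by decide), h2]
    · intro x t v τ h
      simpa using h
    · rintro y u hy ⟨h7, hv⟩ h9 hB
      have hu2 : u.reg 2 = 1 := by rw [hB.reg 2 (by decide), hA.reg 2 (by decide), h2]
      have hu8 : u.reg 8 = x := by rw [hB.reg 8 (by decide), h8]
      simp only [wp_block_cons, wp_block_nil, wp_op, Op.Valid, width, Op.run, Nat.reduceLT,
        true_and, Function.update_apply, Nat.reduceEqDiff, if_true, if_false, h7, h9, hu2, hu8]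
      refine ⟨⟨by ring, fun v hv' => ?_⟩, by omega⟩
      by_cases e : v = s.reg 0 * x + y
      · have hn : 0 < s.reg 0 := by omega
        rw [h0] at hy
        simp [e, Nat.mul_add_div hn, Nat.div_eq_of_lt hy, Nat.mod_eq_of_lt hy]
      · simpa [e] using hv v (by omega)
    · rintro u - ⟨⟨h7, hv⟩, ht⟩
      rw [h0] at h7 hv ht
      exact ⟨⟨by rw [h7]; ring, fun v hv' => hv v (by rwa [← Nat.mul_succ])⟩, by omega⟩
  · rintro t - ⟨⟨h7, h⟩, ht⟩
    refine ⟨h7, h, ht.trans ?_⟩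
    rw [show 2 + s.reg 0 * 5 + 2 = 4 + s.reg 0 * 5 by omega]

theorem wp_setupCmd {inp : List ℕ} {n k : ℕ} (h : IsInput inp n k) (s : Store) :
    wp inp setupCmd (fun t => Env inp n k t ∧ t.time ≤ s.time + 30 + 20 * n ^ 2) s := by
  have hn := h.start
  have hlen := h.length
  rw [setupCmd]
  simp only [wp_block_cons, wp_op, Op.Valid, Op.run, Nat.reduceAdd, true_and,
      Function.update_apply, Nat.reduceEqDiff, if_true, if_false, h.states, h.letters]
  refine ⟨by omega, by omega, by omega, ?_⟩
  refine (wp_mulTables (by simp) (by simp) (by simp)).mono ?_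
  rintro t hA ⟨ht, htt⟩
  simp only [Function.update_apply, Nat.reduceEqDiff, if_true, if_false] at ht htt
  rw [wp_block_cons, wp_op]
  refine ⟨trivial, ?_⟩
  rw [wp_block_cons]
  refine (wp_pairTables ?_ rfl).mono ?_
  · simp only [Op.run, Function.update_apply, Nat.reduceEqDiff, if_false]
    rw [hA.reg 2 (by decide)]
    simp
  rintro u hB ⟨hu7, hu, htu⟩
  rw [wp_block_cons, wp_op, wp_block_nil]
  refine ⟨trivial, ?_⟩
  have hreg : ∀ r < 6, u.reg r = t.reg r := by
    intro r hr
    rw [hB.reg r (by simp [Cmd.regs, Cmd.forLt, Cmd.block]; omega)]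
    simp only [Op.run, Function.update_apply]
    rw [if_neg (by omega)]
  have hreg' : ∀ r < 6, t.reg r = _ := fun r hr =>
    hA.reg r (by simp [Cmd.regs, Cmd.forLt, Cmd.block]; omega)
  have hu0 : u.reg 0 = n := by rw [hreg 0 (by omega), hreg' 0 (by omega)]; simp
  have hu3 : u.reg 3 = 0 := by rw [hreg 3 (by omega), hreg' 3 (by omega)]; simp
  have harr : ∀ j, j ≠ 0 → j ≠ 1 → u.arr j = t.arr j := fun j h0 h1 =>
    hB.arr j (by simp [Cmd.arrs, Cmd.forLt, Cmd.block]; omega)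
  have ht0 : t.reg 0 = n := by rw [hreg' 0 (by omega)]; simp
  simp only [Op.run, Function.update_apply, Nat.reduceEqDiff, if_false, ht0] at hu7 hu htu
  refine ⟨⟨?_, ?_, ?_, ?_, ?_, ?_, ?_, ?_, ?_, ?_, ?_⟩, ?_⟩
  · simpa [Op.run] using hu0
  · simp [Op.run, hreg, hreg']
  · simp [Op.run, hreg, hreg']
  · simp [Op.run, hreg, hreg']
  · simp [Op.run, hreg, hreg']
  · simp [Op.run, hreg, hreg']
  · simp [Op.run, hu7, hu3]
  · exact fun v hv => (hu v hv).1
  · exact fun v hv => (hu v hv).2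
  · intro p hp
    simp only [Op.run]
    rw [harr 2 (by omega) (by omega), (ht p hp).1]
  · intro p hp
    simp only [Op.run]
    rw [harr 3 (by omega) (by omega), (ht p hp).2]
  · simp only [Op.run]
    nlinarith

end RAM

/-! ### Adjacency lists of the reversed graph -/

namespace RAM

/-- The linked list starting at cell `h`, with successor function `nx` and contents `sr`, has the
entries `l`; its cells are positive numbers below `e`, and `0` marks the end. -/
def Chain (nx sr : ℕ → ℕ) (e : ℕ) : ℕ → List ℕ → Prop
  | h, [] => h = 0
  | h, v :: l => 0 < h ∧ h < e ∧ sr h = v ∧ Chain nx sr e (nx h) l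

/-- All cells of the chain lie below `e`, so writing to the fresh cell `e` does not disturb it. This
lets all lists share one pool of cells. -/
theorem Chain.update {nx sr : ℕ → ℕ} {e h : ℕ} {l : List ℕ} (hc : Chain nx sr e h l) (x y : ℕ) :
    Chain (Function.update nx e x) (Function.update sr e y) (e + 1) h l := by
  induction l generalizing h with
  | nil => exact hc
  | cons v l ih =>
    obtain ⟨h₀, h₁, h₂, h₃⟩ := hc
    refine ⟨h₀, by omega, ?_, ?_⟩
    · rw [Function.update_of_ne h₁.ne, h₂]
    · rw [Function.update_of_ne h₁.ne]
      exact ih h₃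

theorem Chain.insert {nx sr hd : ℕ → ℕ} {e : ℕ} {adj : ℕ → List ℕ} (he : 0 < e)
    (hc : ∀ w, Chain nx sr e (hd w) (adj w)) (v x w : ℕ) :
    Chain (Function.update nx e (hd x)) (Function.update sr e v) (e + 1)
      (Function.update hd x e w) (if x = w then v :: adj w else adj w) := by
  by_cases h : x = w
  · subst h
    simp only [Function.update_self, if_true]
    exact ⟨he, by omega, by simp, by simpa using (hc x).update _ _⟩
  · rw [Function.update_of_ne (Ne.symm h), if_neg h]
    exact (hc w).update _ _

/-- The vertices `u < v`, each listed as many times as there are edges from `u` to `w`, in the graph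
in which edge number `a < k` of the vertex `u` goes to `T u a`. -/
def preds (T : ℕ → ℕ → ℕ) (k : ℕ) : ℕ → ℕ → List ℕ
  | 0, _ => []
  | v + 1, w => List.replicate (Nat.count (fun a => T v a = w) k) v ++ preds T k v w

theorem count_preds (T : ℕ → ℕ → ℕ) (k v w u : ℕ) :
    (preds T k v w).count u = if u < v then Nat.count (fun a => T u a = w) k else 0 := by
  induction v with
  | zero => simp [preds]
  | succ v ih =>
    rw [preds, List.count_append, ih, List.count_replicate]
    rcases lt_trichotomy u v with h | h | h
    · simp [h, h.ne', Nat.lt_succ_of_lt h]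
    · simp [h]
    · simp [show ¬ u < v by omega, show ¬ u < v + 1 by omega, h.ne]

theorem lt_of_mem_preds {T : ℕ → ℕ → ℕ} {k v w u : ℕ} (h : u ∈ preds T k v w) : u < v := by
  by_contra hn
  have := List.count_pos_iff.2 h
  rw [count_preds, if_neg hn] at this
  omega

theorem sum_count_eq {N : ℕ} (f : ℕ → ℕ) (k : ℕ) (hf : ∀ a < k, f a < N) :
    ∑ w ∈ Finset.range N, Nat.count (fun a => f a = w) k = k := by
  induction k with
  | zero => simp
  | succ k ih =>
    simp only [Nat.count_succ, Finset.sum_add_distrib]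
    rw [ih fun a ha => hf a (by omega), Finset.sum_ite_eq, if_pos]
    exact Finset.mem_range.2 (hf k (by omega))

/-- Each of the `k * v` edges appears in exactly one list, that of its target. This is the amortised
bound on the propagation. -/
theorem sum_length_preds {N : ℕ} (T : ℕ → ℕ → ℕ) (k v : ℕ) (hT : ∀ u < v, ∀ a < k, T u a < N) :
    ∑ w ∈ Finset.range N, (preds T k v w).length = k * v := by
  induction v with
  | zero => simp [preds]
  | succ v ih =>
    simp only [preds, List.length_append, List.length_replicate, Finset.sum_add_distrib]
    rw [ih fun u hu => hT u (by omega), sum_count_eq _ _ (hT v (by omega))]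
    ring

/-- Building the adjacency lists of the reversed graph in the arrays `h` (first cells), `nx`
(successors) and `sr` (contents). The command `target` puts the target of edge number `reg 8` of
vertex number `reg 7` into register `12`. -/
def buildCmd (h nx sr : ℕ) (target : Cmd) : Cmd := .block [
  .op (.const 9 1),
  .forLt 7 6 (.block [
    .op (.get 10 0 7), .op (.get 11 1 7), .op (.get 13 3 10), .op (.add 13 13 5),
    .op (.get 14 3 11), .op (.add 14 14 5),
    .forLt 8 1 (.block [
      target, .op (.put sr 9 7), .op (.get 15 h 12), .op (.put nx 9 15), .op (.put h 12 9),
      .op (.add 9 9 2)])])]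

/-- The command `target` computes the function `T`. -/
def ComputesTarget (inp : List ℕ) (n k : ℕ) (T : ℕ → ℕ → ℕ) (target : Cmd) : Prop :=
  ∀ s v a, v < n * n → a < k → Env inp n k s → s.reg 7 = v → s.reg 8 = a → s.reg 10 = v / n →
    s.reg 11 = v % n → s.reg 13 = n + 3 + k * (v / n) → s.reg 14 = n + 3 + k * (v % n) →
    wp inp target (fun t => t.reg 12 = T v a ∧ t.time ≤ s.time + 10) s

theorem wp_insertCmd {inp : List ℕ} {h nx sr e v w : ℕ} {s : Store} {adj : ℕ → List ℕ}
    (hw : h < width ∧ nx < width ∧ sr < width) (hd : h ≠ nx ∧ h ≠ sr ∧ nx ≠ sr)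
    (h2 : s.reg 2 = 1) (h7 : s.reg 7 = v) (h12 : s.reg 12 = w) (h9 : s.reg 9 = e) (he : 0 < e)
    (hc : ∀ w, Chain (s.arr nx) (s.arr sr) e (s.arr h w) (adj w)) :
    wp inp (.block [.op (.put sr 9 7), .op (.get 15 h 12), .op (.put nx 9 15), .op (.put h 12 9),
      .op (.add 9 9 2)])
      (fun t => t.reg 9 = e + 1 ∧ (∀ x, Chain (t.arr nx) (t.arr sr) (e + 1) (t.arr h x)
        (if w = x then v :: adj x else adj x)) ∧ t.time ≤ s.time + 5) s := by
  obtain ⟨hh, hn, hs⟩ := hw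
  obtain ⟨d₁, d₂, d₃⟩ := hd
  simp only [wp_block_cons, wp_block_nil, wp_op, Op.Valid, Op.run, hh, hn, hs, true_and,
    Function.update_self, Function.update_of_ne, ne_eq, Nat.reduceEqDiff, not_false_eq_true, h7,
    h12, h9, h2, d₁, d₂, d₃, d₁.symm, d₂.symm, d₃.symm]
  exact ⟨fun x => Chain.insert he hc v w x, by omega⟩

/-- The heads must start at zero because `0` encodes the empty list; for the same reason cells are
allocated from `1` on. -/
theorem wp_buildCmd {inp : List ℕ} {n k h nx sr : ℕ} {T : ℕ → ℕ → ℕ} {target : Cmd}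
    (hw : h < width ∧ nx < width ∧ sr < width) (hd : h ≠ nx ∧ h ≠ sr ∧ nx ≠ sr)
    (h4 : 4 ≤ h ∧ 4 ≤ nx ∧ 4 ≤ sr)
    (ht : ComputesTarget inp n k T target) (hr : ∀ r ∈ target.regs, r = 12 ∨ 15 ≤ r)
    (ha : target.arrs = []) {s : Store} (hs : Env inp n k s) (hz : ∀ w, s.arr h w = 0) :
    wp inp (buildCmd h nx sr target) (fun t => Env inp n k t ∧
      (∃ e, ∀ w, Chain (t.arr nx) (t.arr sr) e (t.arr h w) (preds T k (n * n) w)) ∧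
      t.time ≤ s.time + 3 + n * n * (10 + k * 17)) s := by
  have hr' : ∀ r < 12, r ∉ target.regs := fun r h h' => by
    have := hr r h'
    omega
  rw [buildCmd, wp_block_cons, wp_op]
  refine ⟨trivial, ?_⟩
  rw [wp_block_cons]
  have hs₁ : Env inp n k ((Op.const 9 1).run inp s) :=
    hs.of_agree (R := [9]) (A := []) ⟨fun r hr => Function.update_of_ne (by simpa using hr) _ _,
      fun _ _ => rfl⟩ (by simp) (by simp)
  refine (wp_forLt (fun v t => 0 < t.reg 9 ∧ ∀ w, Chain (t.arr nx) (t.arr sr) (t.reg 9) (t.arr h w)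
    (preds T k v w)) (8 + k * 17) (by simp [Cmd.regs, Cmd.block, Cmd.forLt, hr'])
    (by simp [Cmd.regs, Cmd.block, Cmd.forLt, hr']) (by decide)
    (by simp [Cmd.regs, Cmd.block, Cmd.forLt, hr']) (by decide) hs₁.one ?_ ?_ ?_).mono ?_
  · intro x t v τ h
    simpa using h
  · simp [Op.run, preds, Chain, hz]
  · rintro v t hv ⟨h9, hc⟩ h7 hA
    have hE : Env inp n k t := hs₁.of_agree hA
      (by
        simp [Cmd.regs, Cmd.block, Cmd.forLt]
        rintro r (h | h)
        · have := hr r h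
          omega
        · omega)
      (by simp [Cmd.arrs, Cmd.block, Cmd.forLt, ha, h4])
    rw [hs₁.pairs] at hv
    have hn : 0 < n := by
      rcases Nat.eq_zero_or_pos n with h | h
      · simp [h] at hv
      · exact h
    have hdiv : v / n < n := Nat.div_lt_of_lt_mul hv
    have hmod : v % n < n := Nat.mod_lt _ hn
    simp only [wp_block_cons, wp_op, Op.Valid, width, Op.run, Nat.reduceLT, true_and,
      Function.update_apply, Nat.reduceEqDiff, if_true, if_false, h7, hE.div v hv, hE.mod v hv,
      hE.mulLetters _ hdiv, hE.mulLetters _ hmod, hE.offset]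
    -- After `a` edges of `v`, each list has in front the part of the block of `v` coming from these
    -- edges; at `a = k` this is `preds` at `v + 1`.
    refine (wp_forLt (fun a t => 0 < t.reg 9 ∧ ∀ w, Chain (t.arr nx) (t.arr sr) (t.reg 9)
      (t.arr h w) (List.replicate (Nat.count (fun a => T v a = w) a) v ++ preds T k v w)) 15
      (by simp [Cmd.regs, Cmd.block, hr']) (by simp [Cmd.regs, Cmd.block, hr']) (by decide)
      (by simp [Cmd.regs, Cmd.block, hr']) (by decide) ?_ ?_ ?_ ?_).mono ?_
    · simp [hE.one]
    · intro x t v τ h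
      simpa using h
    · simpa using ⟨h9, hc⟩
    · rintro a u hak ⟨h9, hc⟩ h8 hB
      have hE' : Env inp n k u := by
        refine Env.of_agree ?_ hB ?_ ?_
        · refine hE.of_agree (R := [10, 11, 13, 14]) (A := []) ⟨?_, fun _ _ => rfl⟩ (by simp)
            (by simp)
          intro r hr
          simp at hr
          simp [hr]
        · simp [Cmd.regs, Cmd.block]
          rintro r (h | h)
          · have := hr r h
            omega
          · omega
        · simp [Cmd.arrs, Cmd.block, ha, h4]
      have hB' : ∀ r, 7 ≤ r → r ≠ 8 → r ≠ 9 → r ≠ 12 → r < 15 → u.reg r = _ := fun r _ _ _ _ _ =>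
        hB.reg r (by
          simp [Cmd.regs, Cmd.block]
          refine ⟨by omega, fun h => ?_, by omega, by omega⟩
          have := hr r h
          omega)
      simp only [Function.update_apply, Nat.reduceEqDiff, if_false, hE.letters] at hak
      rw [wp_block_cons]
      refine (ht u v a hv hak hE' ?_ h8 ?_ ?_ ?_ ?_).mono ?_
      · rw [hB'] <;> simp [h7]
      · rw [hB'] <;> simp
      · rw [hB'] <;> simp
      · rw [hB'] <;> simp [add_comm]
      · rw [hB'] <;> simp [add_comm]
      rintro x hx ⟨h12, htx⟩
      refine (wp_insertCmd (e := u.reg 9) (v := v) (adj := fun w =>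
        List.replicate (Nat.count (fun a => T v a = w) a) v ++ preds T k v w) hw hd ?_ ?_ h12 ?_ h9
        ?_).mono ?_
      · rw [hx.reg 2 (hr' 2 (by omega)), hE'.one]
      · rw [hx.reg 7 (hr' 7 (by omega)), hB' 7] <;> simp [h7]
      · rw [hx.reg 9 (hr' 9 (by omega))]
      · simpa only [hx.arr _ (show _ ∉ target.arrs by simp [ha])] using hc
      · rintro y - ⟨h9', hc', hty⟩
        refine ⟨⟨by omega, fun w => ?_⟩, by omega⟩
        rw [h9', Nat.count_succ]
        convert hc' w using 1
        split_ifs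
        · rw [List.replicate_succ, List.cons_append]
        · rfl
    · rintro u - ⟨⟨h9, hc⟩, htu⟩
      simp only [Function.update_apply, Nat.reduceEqDiff, if_false, hE.letters] at hc htu
      rw [wp_block_nil]
      exact ⟨⟨h9, hc⟩, by omega⟩
  · rintro t hA ⟨⟨-, hc⟩, htt⟩
    rw [hs₁.pairs] at hc htt
    rw [wp_block_nil]
    refine ⟨hs₁.of_agree hA ?_ ?_, ⟨_, hc⟩, ?_⟩
    · simp [Cmd.regs, Cmd.block, Cmd.forLt]
      rintro r (h | h)
      · have := hr r h
        omega
      · omega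
    · simp [Cmd.arrs, Cmd.block, Cmd.forLt, ha, h4]
    · refine htt.trans ?_
      simp only [Op.run]
      rw [show 8 + k * 17 + 2 = 10 + k * 17 by omega]

end RAM

/-! ### Least fixed points: counters and the initial queue -/

namespace RAM

/-- The least set containing the vertices satisfying `I` and every vertex with at least `th` edges
into the set, in the graph on the numbers below `N` in which edge number `a < k` of the vertex `u`
goes to `T u a`. -/
inductive Derives (N k th : ℕ) (T : ℕ → ℕ → ℕ) (I : ℕ → Prop) : ℕ → Prop
  | init {u} : u < N → I u → Derives N k th T I u
  | step {u} (A : Finset ℕ) : u < N → A ⊆ Finset.range k → th ≤ A.card →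
      (∀ a ∈ A, Derives N k th T I (T u a)) → Derives N k th T I u

/-- The invariant of the propagation algorithm: `qs` lists the vertices derived so far, `m u` is the
number of processed edges from `u`, and `cnt u` is the number of edges still missing for `u`. -/
structure Progress (N th : ℕ) (I : ℕ → Prop) (m : ℕ → ℕ) (qs : List ℕ) (cnt : ℕ → ℕ) : Prop where
  nodup : qs.Nodup
  lt : ∀ v ∈ qs, v < N
  mem : ∀ v < N, v ∈ qs ↔ I v ∨ th ≤ m v
  cnt_of : ∀ v < N, I v → cnt v = 0
  cnt_of_not : ∀ v < N, ¬ I v → cnt v = th - m v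

namespace Progress

variable {N th v : ℕ} {I : ℕ → Prop} {m cnt : ℕ → ℕ} {qs : List ℕ}

/-- The counter array doubles as the membership test for the queue, and in the end as the output. -/
theorem cnt_eq_zero_iff (h : Progress N th I m qs cnt) (hv : v < N) : cnt v = 0 ↔ v ∈ qs := by
  rw [h.mem v hv]
  by_cases hI : I v
  · simp [hI, h.cnt_of v hv hI]
  · simp only [h.cnt_of_not v hv hI, hI, false_or]
    omega

theorem zero (cnt : ℕ → ℕ) : Progress 0 th I m [] cnt :=
  ⟨List.nodup_nil, by simp, by simp, by simp, by simp⟩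

theorem extend (h : Progress N th I (fun _ => 0) qs cnt) (hI : I N) :
    Progress (N + 1) th I (fun _ => 0) (qs ++ [N]) (Function.update cnt N 0) := by
  have hN : N ∉ qs := fun hN => (h.lt N hN).false
  refine ⟨?_, ?_, fun v hv => ?_, fun v hv hIv => ?_, fun v hv hIv => ?_⟩
  · simpa [List.nodup_append, h.nodup] using fun a ha (e : a = N) => hN (e ▸ ha)
  · intro v hv
    rcases List.mem_append.1 hv with hv | hv
    · exact (h.lt v hv).trans (Nat.lt_succ_self N)
    · simp at hv
      omega
  all_goals rcases Nat.lt_succ_iff_lt_or_eq.1 hv with hv | rfl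
  · simp [h.mem v hv, hv.ne]
  · simp [hI]
  · simp [hv.ne, h.cnt_of v hv hIv]
  · simp
  · simp [hv.ne, h.cnt_of_not v hv hIv]
  · exact absurd hI hIv

/-- A positive threshold is essential: with threshold zero the vertex would be derivable without
ever being queued. -/
theorem extend_of_not (h : Progress N th I (fun _ => 0) qs cnt) (hth : 0 < th) (hI : ¬ I N) :
    Progress (N + 1) th I (fun _ => 0) qs (Function.update cnt N th) := by
  have hN : N ∉ qs := fun hN => (h.lt N hN).false
  refine ⟨h.nodup, fun v hv => (h.lt v hv).trans (Nat.lt_succ_self N), fun v hv => ?_,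
    fun v hv hIv => ?_, fun v hv hIv => ?_⟩
  all_goals rcases Nat.lt_succ_iff_lt_or_eq.1 hv with hv | rfl
  · simp [h.mem v hv]
  · simp [hI, hN]
    omega
  · simp [hv.ne, h.cnt_of v hv hIv]
  · exact absurd hIv hI
  · simp [hv.ne, h.cnt_of_not v hv hIv]
  · simp

/-- First of three cases for an edge leaving `v`. Here `v` is already queued and nothing changes; in
`step_of_pred_pos` the counter drops but stays positive; in `step_of_eq_one` it reaches zero and `v`
enters the queue. -/
theorem step_of_eq_zero (h : Progress N th I m qs cnt) (hv : v < N) (hc : cnt v = 0) :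
    Progress N th I (fun u => m u + if u = v then 1 else 0) qs cnt := by
  have hq := (h.cnt_eq_zero_iff hv).1 hc
  have hm := (h.mem v hv).1 hq
  refine ⟨h.nodup, h.lt, fun u hu => ?_, h.cnt_of, fun u hu hI => ?_⟩
  all_goals by_cases e : u = v
  · subst e
    simp only [hq, true_iff, if_true]
    exact hm.imp_right fun h => by omega
  · simp [e, h.mem u hu]
  · subst e
    have := hm.resolve_left hI
    simp only [hc, if_true]
    omega
  · simp [e, h.cnt_of_not u hu hI]

theorem step_of_pred_pos (h : Progress N th I m qs cnt) (hv : v < N) (hc : 1 < cnt v) :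
    Progress N th I (fun u => m u + if u = v then 1 else 0) qs
      (Function.update cnt v (cnt v - 1)) := by
  have hq : v ∉ qs := fun hq => by
    have := (h.cnt_eq_zero_iff hv).2 hq
    omega
  have hI : ¬ I v := fun hI => hq ((h.mem v hv).2 (.inl hI))
  have hm := h.cnt_of_not v hv hI
  refine ⟨h.nodup, h.lt, fun u hu => ?_, fun u hu hIu => ?_, fun u hu hIu => ?_⟩
  all_goals by_cases e : u = v
  · subst e
    simp only [hq, hI, if_true, false_or, false_iff]
    omega
  · simp [e, h.mem u hu]
  · exact absurd (e ▸ hIu) hI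
  · simp [e, h.cnt_of u hu hIu]
  · subst e
    simp only [Function.update_self, if_true]
    omega
  · simp [e, h.cnt_of_not u hu hIu]

theorem step_of_eq_one (h : Progress N th I m qs cnt) (hv : v < N) (hc : cnt v = 1) :
    Progress N th I (fun u => m u + if u = v then 1 else 0) (qs ++ [v])
      (Function.update cnt v 0) := by
  have hq : v ∉ qs := fun hq => by
    have := (h.cnt_eq_zero_iff hv).2 hq
    omega
  have hI : ¬ I v := fun hI => hq ((h.mem v hv).2 (.inl hI))
  have hm := h.cnt_of_not v hv hI
  refine ⟨?_, ?_, fun u hu => ?_, fun u hu hIu => ?_, fun u hu hIu => ?_⟩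
  · simpa [List.nodup_append, h.nodup] using fun a ha (e : a = v) => hq (e ▸ ha)
  · intro u hu
    rcases List.mem_append.1 hu with hu | hu
    · exact h.lt u hu
    · simp at hu
      omega
  all_goals by_cases e : u = v
  · subst e
    simp only [List.mem_append, List.mem_singleton, or_true, true_iff, if_true]
    right
    omega
  · simp [e, h.mem u hu]
  · exact absurd (e ▸ hIu) hI
  · simp [e, h.cnt_of u hu hIu]
  · subst e
    simp only [Function.update_self, if_true]
    omega
  · simp [e, h.cnt_of_not u hu hIu]

end Progress

/-- The queue in array `10`; register `9` holds its length. -/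
def Store.queue (s : Store) : List ℕ := (List.range (s.reg 9)).map (s.arr 10)

theorem Store.queue_congr {s t : Store} (h : t.reg 9 = s.reg 9) (h' : t.arr 10 = s.arr 10) :
    t.queue = s.queue := by
  rw [queue, queue, h, h']

theorem Store.queue_push {s t : Store} {v : ℕ} (h : t.reg 9 = s.reg 9 + 1)
    (h' : t.arr 10 = Function.update (s.arr 10) (s.reg 9) v) : t.queue = s.queue ++ [v] := by
  rw [queue, queue, h, h', List.range_succ, List.map_append]
  congr 1
  · refine List.map_congr_left fun i hi => Function.update_of_ne ?_ _ _
    exact (List.mem_range.1 hi).ne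
  · simp

/-- Initialising the array `c` of counters and the queue. The command `cond` puts a positive number
into register `12` if the vertex in register `7` is to be derived unconditionally; register `th`
holds the threshold. -/
def initCmd (c th : ℕ) (cond : Cmd) : Cmd := .block [
  .op (.const 9 0),
  .forLt 7 6 (.block [
    .op (.get 10 0 7), .op (.get 11 1 7), cond,
    .ite 3 12 (.block [.op (.put c 7 3), .op (.put 10 9 7), .op (.add 9 9 2)]) (.op (.put c 7 th))])]

/-- The command `cond` decides the predicate `I`, in stores with the same arrays as `s` except for
the queue and the array `c`. -/
def Decides (inp : List ℕ) (n k c : ℕ) (I : ℕ → Prop) (cond : Cmd) (s : Store) : Prop :=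
  ∀ t v, v < n * n → (∀ j, j ≠ 10 → j ≠ c → t.arr j = s.arr j) → Env inp n k t → t.reg 7 = v →
    t.reg 10 = v / n → t.reg 11 = v % n →
    wp inp cond (fun u => (0 < u.reg 12 ↔ I v) ∧ u.time ≤ t.time + 20) t

/-- The loop invariant is `Progress` on the vertices below the current one, with no edges processed.
The threshold lies among the constant registers, which the loop does not write. -/
theorem wp_initCmd {inp : List ℕ} {n k c th : ℕ} {I : ℕ → Prop} {cond : Cmd} {s : Store}
    (hc : c < width) (hc4 : 4 ≤ c) (hc10 : c ≠ 10) (hth : 0 < s.reg th) (hth7 : th < 7)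
    (hcond : Decides inp n k c I cond s) (hr : ∀ r ∈ cond.regs, 12 ≤ r) (ha : cond.arrs = [])
    (hs : Env inp n k s) :
    wp inp (initCmd c th cond) (fun t => Env inp n k t ∧
      Progress (n * n) (s.reg th) I (fun _ => 0) t.queue (t.arr c) ∧
      t.time ≤ s.time + 3 + n * n * 30) s := by
  have hr' : ∀ r < 12, r ∉ cond.regs := fun r h h' => by
    have := hr r h'
    omega
  rw [initCmd, wp_block_cons, wp_op]
  refine ⟨trivial, ?_⟩
  rw [wp_block_cons]
  have hs₁ : Env inp n k ((Op.const 9 0).run inp s) :=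
    hs.of_agree (R := [9]) (A := []) ⟨fun r hr => Function.update_of_ne (by simpa using hr) _ _,
      fun _ _ => rfl⟩ (by simp) (by simp)
  refine (wp_forLt (fun v t => Progress v (s.reg th) I (fun _ => 0) t.queue (t.arr c)) 28
    (by simp [Cmd.regs, Cmd.block, hr']) (by simp [Cmd.regs, Cmd.block, hr']) (by decide)
    (by simp [Cmd.regs, Cmd.block, hr']) (by decide) hs₁.one ?_ ?_ ?_).mono ?_
  · intro x t v τ h
    rwa [Store.queue_congr (s := t)]
    · simp
    · rfl
  · simpa [Store.queue, Op.run] using Progress.zero _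
  · intro v t hv hP h7 hA
    rw [hs₁.pairs] at hv
    have hregs : ∀ r ∈ 7 :: (Cmd.block [
        .op (.get 10 0 7), .op (.get 11 1 7), cond, .ite 3 12 (.block [.op (.put c 7 3),
        .op (.put 10 9 7), .op (.add 9 9 2)]) (.op (.put c 7 th))]).regs, 7 ≤ r := by
      simp [Cmd.regs, Cmd.block]
      rintro r (h | h)
      · have := hr r h
        omega
      · omega
    have hE : Env inp n k t :=
      hs₁.of_agree hA hregs (by simp [Cmd.arrs, Cmd.block, ha, hc4])
    have hth' : t.reg th = s.reg th := by
      rw [hA.reg th fun h => by have := hregs th h; omega]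
      exact Function.update_of_ne (by omega) _ _
    rw [wp_block_cons, wp_op, wp_block_cons, wp_op, wp_block_cons]
    refine ⟨by simp [Op.Valid, width], by simp [Op.Valid, width], ?_⟩
    simp only [Op.run, Function.update_apply, Nat.reduceEqDiff, if_false, h7, hE.div v hv,
      hE.mod v hv]
    refine (hcond _ v hv ?_ ?_ ?_ ?_ ?_).mono ?_
    · intro j h₁ h₂
      exact hA.arr j (by simp [Cmd.arrs, Cmd.block, ha, h₁, h₂])
    · refine hE.of_agree (R := [10, 11]) (A := []) ⟨?_, fun _ _ => rfl⟩ (by simp) (by simp)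
      intro r hr
      simp at hr
      simp [hr]
    · simp [h7]
    · simp
    · simp
    · rintro u hu ⟨hI, htu⟩
      have hu3 : u.reg 3 = 0 := by rw [hu.reg 3 (hr' 3 (by omega))]; simp [hE.zero]
      have hu2 : u.reg 2 = 1 := by rw [hu.reg 2 (hr' 2 (by omega))]; simp [hE.one]
      have hu7 : u.reg 7 = v := by rw [hu.reg 7 (hr' 7 (by omega))]; simp [h7]
      have hu9 : u.reg 9 = t.reg 9 := by rw [hu.reg 9 (hr' 9 (by omega))]; simp
      have huth : u.reg th = s.reg th := by
        rw [hu.reg th (hr' th (by omega))]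
        simp [show th ≠ 10 by omega, show th ≠ 11 by omega, hth']
      have hua : ∀ j, u.arr j = t.arr j := fun j => hu.arr j (by simp [ha])
      rw [wp_block_cons, wp_ite, hu3]
      split_ifs with h12
      · simp only [wp_block_cons, wp_block_nil, wp_op, Op.Valid, Op.run, Store.tick, hc, true_and,
          hu3, hu7, hu2, hu9]
        refine ⟨by decide, ?_, by dsimp only at htu ⊢; omega⟩
        rw [Store.queue_push (s := t) (v := v)]
        · simp only [Function.update_of_ne hc10, Function.update_self, hua]
          exact hP.extend (hI.1 h12)
        · simp
        · simp [Function.update_of_ne hc10.symm, hua]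
      · simp only [wp_block_nil, wp_op, Op.Valid, Op.run, Store.tick, hc, true_and, hu7, huth]
        refine ⟨?_, by dsimp only at htu ⊢; omega⟩
        rw [Store.queue_congr (s := t)]
        · simp only [Function.update_self, hua]
          exact hP.extend_of_not hth fun h => h12 (hI.2 h)
        · simp [hu9]
        · simp [Function.update_of_ne hc10.symm, hua]
  · rintro t hA ⟨hP, ht⟩
    rw [hs₁.pairs] at hP ht
    rw [wp_block_nil]
    refine ⟨hs₁.of_agree hA ?_ ?_, hP, ?_⟩
    · simp [Cmd.regs, Cmd.block, Cmd.forLt]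
      rintro r (h | h)
      · have := hr r h
        omega
      · omega
    · simp [Cmd.arrs, Cmd.block, Cmd.forLt, ha, hc4]
    · simp only [Op.run] at ht ⊢
      omega

end RAM

/-! ### Least fixed points: propagation -/

namespace RAM

theorem count_or_of_disjoint {p q : ℕ → Prop} [DecidablePred p] [DecidablePred q]
    (h : ∀ a, p a → ¬ q a) (k : ℕ) :
    Nat.count (fun a => p a ∨ q a) k = Nat.count p k + Nat.count q k := by
  induction k with
  | zero => simp
  | succ k ih =>
    have := h k
    simp only [Nat.count_succ, ih]
    split_ifs <;> first | omega | tauto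

/-- Since `d` has no repetitions, an edge into `d` is counted for exactly one entry. -/
theorem sum_map_count (f : ℕ → ℕ) (k : ℕ) {d : List ℕ} (hd : d.Nodup) :
    (d.map fun w => Nat.count (fun a => f a = w) k).sum = Nat.count (fun a => f a ∈ d) k := by
  induction d with
  | nil => simp
  | cons w d ih =>
    rw [List.nodup_cons] at hd
    simp only [List.map_cons, List.sum_cons, ih hd.2, List.mem_cons]
    rw [count_or_of_disjoint]
    rintro a rfl
    exact hd.1

/-- Processing one edge of the linked list whose current cell is in register `11`. -/
def relaxCmd (c nx sr : ℕ) : Cmd := .block [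
  .op (.get 12 sr 11), .op (.get 11 nx 11), .op (.get 13 c 12),
  .ite 3 13 (.block [.op (.sub 13 13 2), .op (.put c 12 13),
    .ite 13 2 (.block [.op (.put 10 9 12), .op (.add 9 9 2)]) .skip]) .skip]

theorem wp_relaxCmd {inp : List ℕ} {N c nx sr th v : ℕ} {I : ℕ → Prop} {m : ℕ → ℕ} {s : Store}
    (hw : c < width ∧ nx < width ∧ sr < width) (hc10 : c ≠ 10) (h2 : s.reg 2 = 1)
    (h3 : s.reg 3 = 0) (hv : s.arr sr (s.reg 11) = v) (hvN : v < N)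
    (hP : Progress N th I m s.queue (s.arr c)) :
    wp inp (relaxCmd c nx sr) (fun t => t.reg 11 = s.arr nx (s.reg 11) ∧
      (∃ l, t.queue = s.queue ++ l) ∧
      Progress N th I (fun u => m u + if u = v then 1 else 0) t.queue (t.arr c) ∧
      t.time ≤ s.time + 9) s := by
  obtain ⟨hc, hn, hs⟩ := hw
  simp only [relaxCmd, wp_block_cons, wp_op, Op.Valid, Op.run, hc, hn, hs, true_and, wp_ite,
    Store.tick, Function.update_apply, Nat.reduceEqDiff, if_false, if_true, hv, h3, h2,
    wp_skip, wp_block_nil, hc10.symm]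
  have hw10 : 10 < width := by decide
  simp only [hw10, true_and]
  split_ifs with h₁ h₂
  · have h₃ : s.arr c v = 1 := by omega
    refine ⟨⟨[v], Store.queue_push rfl (by simp)⟩, ?_, by omega⟩
    rw [Store.queue_push (s := s) (v := v) rfl (by simp)]
    simpa [hc10, h₃] using hP.step_of_eq_one hvN h₃
  · refine ⟨⟨[], Eq.trans (Store.queue_congr ?_ ?_) (List.append_nil _).symm⟩, ?_, by omega⟩
    · rfl
    · simp [hc10.symm]
    · convert hP.step_of_pred_pos hvN (show 1 < s.arr c v by omega) using 1
      exact Store.queue_congr rfl (by simp [hc10.symm])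
  · exact ⟨⟨[], (List.append_nil _).symm⟩, hP.step_of_eq_zero hvN (by omega), by omega⟩

/-- A vertex occurs in the list once per edge, so the processed-edge count of `u` grows by the
multiplicity of `u`. A cell costs at most nine units for its processing and one for the test. -/
theorem wp_relaxLoop {inp : List ℕ} {N c nx sr th e : ℕ} {I : ℕ → Prop} {l : List ℕ} :
    ∀ {m : ℕ → ℕ} {s : Store}, c < width ∧ nx < width ∧ sr < width → c ≠ 10 →
      nx ≠ 10 ∧ nx ≠ c ∧ sr ≠ 10 ∧ sr ≠ c → s.reg 2 = 1 → s.reg 3 = 0 →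
      Chain (s.arr nx) (s.arr sr) e (s.reg 11) l → (∀ v ∈ l, v < N) →
      Progress N th I m s.queue (s.arr c) →
      wp inp (.loop 3 11 (relaxCmd c nx sr)) (fun t => (∃ l, t.queue = s.queue ++ l) ∧
        Progress N th I (fun u => m u + l.count u) t.queue (t.arr c) ∧
        t.time ≤ s.time + 1 + 10 * l.length) s := by
  induction l with
  | nil =>
    intro m s hw hc10 hne h2 h3 hC hl hP
    refine wp_loop_false ?_ ⟨⟨[], (List.append_nil _).symm⟩, hP, by simp [Store.tick]⟩
    rw [h3, show s.reg 11 = 0 from hC]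
    omega
  | cons v l ih =>
    intro m s hw hc10 hne h2 h3 hC hl hP
    obtain ⟨h₀, h₁, h₂, h₃⟩ := hC
    refine wp_loop_true (by omega) ?_
    refine (wp_relaxCmd (s := s.tick) (v := v) hw hc10 h2 h3 h₂ (hl v (by simp)) hP).mono ?_
    rintro t ht ⟨h11, ⟨l₁, hl₁⟩, hP', htt⟩
    have hA : ∀ j, j ≠ 10 → j ≠ c → t.arr j = s.arr j := fun j h h' =>
      ht.arr j (by simp [Cmd.arrs, relaxCmd, Cmd.block, h, h'])
    refine (ih hw hc10 hne ?_ ?_ ?_ (fun u hu => hl u (by simp [hu])) hP').mono ?_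
    · rw [ht.reg 2 (by simp [Cmd.regs, relaxCmd, Cmd.block])]
      exact h2
    · rw [ht.reg 3 (by simp [Cmd.regs, relaxCmd, Cmd.block])]
      exact h3
    · rw [hA nx hne.1 hne.2.1, hA sr hne.2.2.1 hne.2.2.2, h11]
      exact h₃
    · rintro u - ⟨⟨l₂, hl₂⟩, hPu, htu⟩
      refine ⟨⟨l₁ ++ l₂, ?_⟩, ?_, ?_⟩
      · rw [hl₂, hl₁, List.append_assoc]
        rfl
      · convert hPu using 2 with w
        rw [List.count_cons]
        simp only [beq_iff_eq, @eq_comm _ v]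
        omega
      · simp only [Store.tick, List.length_cons] at htt ⊢
        omega

/-- Propagation along the edges of the reversed graph, until the queue is empty. -/
def propagateCmd (c h nx sr : ℕ) : Cmd := .block [
  .op (.const 8 0),
  .loop 8 9 (.block [.op (.get 10 10 8), .op (.add 8 8 2), .op (.get 11 h 10),
    .loop 3 11 (relaxCmd c nx sr)])]

theorem sum_map_le {N : ℕ} (f : ℕ → ℕ) {d : List ℕ} (hd : d.Nodup) (hN : ∀ v ∈ d, v < N) :
    (d.map f).sum ≤ ∑ w ∈ Finset.range N, f w := by
  rw [← List.sum_toFinset f hd]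
  exact Finset.sum_le_sum_of_subset fun v hv =>
    Finset.mem_range.2 (hN v (List.mem_toFinset.1 hv))

theorem length_le_of_nodup {N : ℕ} {d : List ℕ} (hd : d.Nodup) (hN : ∀ v ∈ d, v < N) :
    d.length ≤ N := by
  simpa using sum_map_le (fun _ => 1) hd hN

theorem length_eq_iff_of_nodup {N : ℕ} {d : List ℕ} (hd : d.Nodup) (hN : ∀ v ∈ d, v < N) :
    d.length = N ↔ ∀ v < N, v ∈ d := by
  have hsub : d.toFinset ⊆ Finset.range N := fun v hv =>
    Finset.mem_range.2 (hN v (List.mem_toFinset.1 hv))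
  rw [← List.toFinset_card_of_nodup hd]
  constructor
  · intro h v hv
    have := Finset.eq_of_subset_of_card_le hsub (by simp [h])
    exact List.mem_toFinset.1 (this ▸ Finset.mem_range.2 hv)
  · intro h
    rw [hsub.antisymm fun v hv => List.mem_toFinset.2 (h v (Finset.mem_range.1 hv)),
      Finset.card_range]

/-- The number of edges from `u` to the vertices in the list `d`. -/
def edgeCount (T : ℕ → ℕ → ℕ) (k N : ℕ) (d : List ℕ) (u : ℕ) : ℕ :=
  (d.map fun w => (preds T k N w).count u).sum

theorem edgeCount_eq {T : ℕ → ℕ → ℕ} {k N u : ℕ} {d : List ℕ} (hd : d.Nodup) (hu : u < N) :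
    edgeCount T k N d u = Nat.count (fun a => T u a ∈ d) k := by
  simp only [edgeCount, count_preds, hu, if_true]
  exact sum_map_count _ _ hd

/-- Soundness of queueing: the edges counted form the finite set required by the rule `step`. -/
theorem Derives.of_le_edgeCount {N k th u : ℕ} {T : ℕ → ℕ → ℕ} {I : ℕ → Prop} {d : List ℕ}
    (hd : d.Nodup) (hu : u < N) (h : ∀ w ∈ d, Derives N k th T I w)
    (hc : th ≤ edgeCount T k N d u) : Derives N k th T I u := by
  rw [edgeCount_eq hd hu, Nat.count_eq_card_filter_range] at hc
  refine .step ((Finset.range k).filter fun a => T u a ∈ d) hu (Finset.filter_subset _ _) hc ?_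
  intro a ha
  exact h _ (Finset.mem_filter.1 ha).2

/-- Completeness: once every queued vertex has been processed, the queue contains the initial
vertices and is closed under the rule, so it contains the least such set. -/
theorem Derives.mem_of_progress {N k th : ℕ} {T : ℕ → ℕ → ℕ} {I : ℕ → Prop} {d : List ℕ}
    {cnt : ℕ → ℕ} (h : Progress N th I (edgeCount T k N d) d cnt) {u : ℕ}
    (hu : Derives N k th T I u) : u ∈ d := by
  induction hu with
  | init hu hI => exact (h.mem _ hu).2 (.inl hI)
  | @step u A hu hA hth _ ih =>
    refine (h.mem _ hu).2 (.inr (hth.trans ?_))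
    rw [edgeCount_eq h.nodup hu, Nat.count_eq_card_filter_range]
    exact Finset.card_le_card fun a ha => Finset.mem_filter.2 ⟨hA ha, ih a ha⟩

/-- Entries are never removed from the queue; register `8` separates the processed prefix from the
rest, and the processed edges are those into the prefix. As the queue has no repetitions, the cost
is at most the sum over all vertices of a constant plus a multiple of the in-degree. -/
theorem wp_propagateCmd {inp : List ℕ} {n k c h nx sr th e : ℕ} {T : ℕ → ℕ → ℕ} {I : ℕ → Prop}
    {s : Store} (hw : c < width ∧ h < width ∧ nx < width ∧ sr < width) (hc10 : c ≠ 10)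
    (hc4 : 4 ≤ c) (hne : nx ≠ 10 ∧ nx ≠ c ∧ sr ≠ 10 ∧ sr ≠ c) (hh : h ≠ 10 ∧ h ≠ c)
    (hT : ∀ v < n * n, ∀ a < k, T v a < n * n) (hth : 0 < th) (hs : Env inp n k s)
    (hC : ∀ w, Chain (s.arr nx) (s.arr sr) e (s.arr h w) (preds T k (n * n) w))
    (hP : Progress (n * n) th I (fun _ => 0) s.queue (s.arr c)) :
    wp inp (propagateCmd c h nx sr) (fun t => Env inp n k t ∧
      (∀ v < n * n, t.arr c v = 0 ↔ Derives (n * n) k th T I v) ∧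
      (n * n ≤ t.reg 9 ↔ ∀ v < n * n, Derives (n * n) k th T I v) ∧
      t.time ≤ s.time + 2 + n * n * (6 + 10 * k)) s := by
  rw [propagateCmd, wp_block_cons, wp_op]
  refine ⟨trivial, ?_⟩
  set s₁ := (Op.const 8 0).run inp s with hs₁
  have hE₁ : Env inp n k s₁ :=
    hs.of_agree (R := [8]) (A := []) ⟨fun r hr => Function.update_of_ne (by simpa using hr) _ _,
      fun _ _ => rfl⟩ (by simp) (by simp)
  rw [wp_block_cons]
  set body := Cmd.block [.op (.get 10 10 8), .op (.add 8 8 2), .op (.get 11 h 10),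
    .loop 3 11 (relaxCmd c nx sr)] with hbody
  -- Induction on `d`, the gap between `n * n` and the read position. At `d = 0` the loop must stop,
  -- because a queue without repetitions has length at most `n * n`.
  have key : ∀ d t, Agree body.regs body.arrs s₁ t → t.reg 8 ≤ t.reg 9 → t.reg 8 + d = n * n →
      Progress (n * n) th I (edgeCount T k (n * n) (t.queue.take (t.reg 8))) t.queue (t.arr c) →
      (∀ v ∈ t.queue, Derives (n * n) k th T I v) →
      t.time ≤ s.time + 1 + ((t.queue.take (t.reg 8)).map fun w =>
        6 + 10 * (preds T k (n * n) w).length).sum →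
      wp inp (.loop 8 9 body) (fun t' =>
        Progress (n * n) th I (edgeCount T k (n * n) t'.queue) t'.queue (t'.arr c) ∧
        (∀ v ∈ t'.queue, Derives (n * n) k th T I v) ∧
        t'.time ≤ s.time + 2 + (t'.queue.map fun w =>
        6 + 10 * (preds T k (n * n) w).length).sum) t := by
    have hlen : ∀ t : Store, t.queue.length = t.reg 9 := fun t => by simp [Store.queue]
    intro d
    induction d with
    | zero =>
      intro t hA hle hd hPt hD ht
      have h9 : t.reg 9 ≤ n * n := hlen t ▸ length_le_of_nodup hPt.nodup hPt.lt
      rw [List.take_of_length_le (by rw [hlen]; omega)] at hPt ht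
      refine wp_loop_false (by omega) ⟨hPt, hD, ?_⟩
      change t.time + 1 ≤ s.time + 2 + (t.queue.map _).sum
      omega
    | succ d ih =>
      intro t hA hle hd hPt hD ht
      by_cases hlt : t.reg 8 < t.reg 9
      swap
      · rw [List.take_of_length_le (by rw [hlen]; omega)] at hPt ht
        refine wp_loop_false (by omega) ⟨hPt, hD, ?_⟩
        change t.time + 1 ≤ s.time + 2 + (t.queue.map _).sum
        omega
      have harr : ∀ j, j ≠ 10 → j ≠ c → t.arr j = s.arr j := fun j h h' =>
        hA.arr j (by simp [hbody, Cmd.arrs, relaxCmd, Cmd.block, h, h'])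
      have hEt : Env inp n k t := hE₁.of_agree hA
        (by simp [hbody, Cmd.regs, relaxCmd, Cmd.block])
        (by simp [hbody, Cmd.arrs, relaxCmd, Cmd.block, hc4])
      set w := t.arr 10 (t.reg 8) with hw'
      have htake : t.queue.take (t.reg 8 + 1) = t.queue.take (t.reg 8) ++ [w] := by
        rw [← List.take_concat_get' _ _ (by rw [hlen]; exact hlt)]
        simp [Store.queue, hw']
      have hnd : (t.queue.take (t.reg 8 + 1)).Nodup := hPt.nodup.sublist (List.take_sublist _ _)
      have hsum : edgeCount T k (n * n) (t.queue.take (t.reg 8 + 1)) = fun u =>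
          edgeCount T k (n * n) (t.queue.take (t.reg 8)) u + (preds T k (n * n) w).count u := by
        funext u
        rw [htake]
        simp [edgeCount]
      refine wp_loop_true hlt ?_
      simp only [hbody, wp_block_cons, wp_op, Op.run, Store.tick]
      refine ⟨by simp [Op.Valid, width], by simp [Op.Valid], hw.2.1, ?_⟩
      refine (wp_relaxLoop (e := e) (l := preds T k (n * n) w) (N := n * n) (th := th) (I := I)
        (m := edgeCount T k (n * n) (t.queue.take (t.reg 8))) ⟨hw.1, hw.2.2.1, hw.2.2.2⟩ hc10 hne
        ?_ ?_ ?_ (fun v hv => lt_of_mem_preds hv) ?_).mono ?_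
      · simp [hEt.one]
      · simp [hEt.zero]
      · simp only [Function.update_self, harr nx hne.1 hne.2.1, harr sr hne.2.2.1 hne.2.2.2,
          harr h hh.1 hh.2]
        simpa using hC w
      · rwa [Store.queue_congr (s := t) (by simp) rfl]
      rintro u hu ⟨⟨l, hl⟩, hPu, htu⟩
      replace hl : u.queue = t.queue ++ l :=
        hl.trans (congrArg (· ++ l) (Store.queue_congr (by simp) rfl))
      have hu8 : u.reg 8 = t.reg 8 + 1 := by
        rw [hu.reg 8 (by simp [Cmd.regs, relaxCmd, Cmd.block])]
        simp [hEt.one]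
      have htake' : u.queue.take (u.reg 8) = t.queue.take (t.reg 8 + 1) := by
        rw [hu8, hl, List.take_append_of_le_length (by rw [hlen]; omega)]
      have hu9 : u.reg 9 = t.reg 9 + l.length := by
        rw [← hlen u, hl, List.length_append, hlen]
      rw [← hsum] at hPu
      rw [wp_block_nil]
      refine ih u (hA.trans ?_) (by omega) (by omega) (by rwa [htake']) ?_ ?_
      · refine Agree.trans (t := ⟨_, _, _⟩) ?_
          (hu.mono (by simp [hbody, Cmd.block, Cmd.regs, relaxCmd])
            (by simp [hbody, Cmd.block, Cmd.arrs]))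
        refine ⟨fun r hr => ?_, fun _ _ => rfl⟩
        simp [hbody, Cmd.regs, Cmd.block] at hr
        simp [hr]
      · intro v hv
        have hvN := hPu.lt v hv
        -- A queued vertex is initial or has enough edges into the processed prefix, whose members
        -- are derived already.
        rcases (hPu.mem v hvN).1 hv with hI | hm
        · exact .init hvN hI
        · exact .of_le_edgeCount hnd hvN (fun w hw => hD w (List.mem_of_mem_take hw)) hm
      · rw [htake', htake, List.map_append, List.sum_append]
        simp only [List.map_cons, List.map_nil, List.sum_cons, List.sum_nil]
        dsimp only at htu
        omega
  refine (key (n * n) s₁ (.refl _ _ _) ?_ ?_ ?_ ?_ ?_).mono ?_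
  · simp [hs₁, Op.run]
  · simp [hs₁, Op.run]
  · rw [Store.queue_congr (s := s) (t := s₁) (by simp [hs₁, Op.run]) rfl,
      show s₁.reg 8 = 0 by simp [hs₁, Op.run], List.take_zero]
    exact hP
  · intro v hv
    exact .init (hP.lt v hv) (((hP.mem v (hP.lt v hv)).1 hv).resolve_right (by omega))
  · simp [hs₁, Op.run]
  · rintro t hA ⟨hPt, hD, ht⟩
    have hmem : ∀ v, v ∈ t.queue ↔ Derives (n * n) k th T I v :=
      fun v => ⟨hD v, fun h => h.mem_of_progress hPt⟩
    have hlen : t.queue.length = t.reg 9 := by simp [Store.queue]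
    rw [wp_block_nil]
    refine ⟨hE₁.of_agree hA ?_ ?_, fun v hv => ?_, ?_, ht.trans ?_⟩
    · simp [Cmd.regs, hbody, relaxCmd, Cmd.block]
    · simp [Cmd.arrs, hbody, relaxCmd, Cmd.block, hc4]
    · rw [hPt.cnt_eq_zero_iff hv, hmem]
    -- Whether every vertex is derived can be read off from the queue length; the final answer uses
    -- this.
    · simp only [← hmem]
      rw [← length_eq_iff_of_nodup hPt.nodup hPt.lt, ← hlen]
      have := length_le_of_nodup hPt.nodup hPt.lt
      omega
    · refine (Nat.add_le_add_left (sum_map_le _ hPt.nodup hPt.lt) _).trans ?_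
      rw [Finset.sum_add_distrib, ← Finset.mul_sum, sum_length_preds T k _ hT]
      simp only [Finset.sum_const, Finset.card_range, smul_eq_mul]
      apply le_of_eq
      ring

end RAM

/-! ### The three fixed points on pairs of states -/

namespace RAM

/-- In the graph of `reachEdge`, the pair `(p, q)` has the edges to the pairs `(p · a, q)`. The pair
`(p, q)` is represented by the number `n * p + q`. -/
def reachEdge (inp : List ℕ) (n k v a : ℕ) : ℕ := n * tableEntry inp n k (v / n) a + v % n

/-- In the graph of `pairEdge`, the pair `(p, q)` has the edges to the pairs `(p · a, q · a)`. -/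
def pairEdge (inp : List ℕ) (n k v a : ℕ) : ℕ :=
  n * tableEntry inp n k (v / n) a + tableEntry inp n k (v % n) a

def reachTargetCmd : Cmd := .block [
  .op (.add 15 13 8), .op (.input 15 15), .op (.get 15 2 15), .op (.add 12 15 11)]

def pairTargetCmd : Cmd := .block [
  .op (.add 15 13 8), .op (.input 15 15), .op (.get 15 2 15),
  .op (.add 16 14 8), .op (.input 16 16), .op (.add 12 15 16)]

theorem IsInput.index_lt {inp : List ℕ} {n k p a : ℕ} (h : IsInput inp n k) (hp : p < n)
    (ha : a < k) : n + 3 + k * p + a < inp.length := by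
  rw [h.length]
  have : k * p + k ≤ n * k := by
    rw [← Nat.mul_succ, mul_comm n]
    exact Nat.mul_le_mul_left k hp
  omega

theorem div_lt_and_mod_lt {n v : ℕ} (hv : v < n * n) : v / n < n ∧ v % n < n :=
  ⟨Nat.div_lt_of_lt_mul hv, Nat.mod_lt _ (Nat.pos_of_ne_zero (by rintro rfl; simp at hv))⟩

theorem mul_add_lt_mul_self {n p q : ℕ} (hp : p < n) (hq : q < n) : n * p + q < n * n :=
  calc n * p + q < n * p + n := by omega
    _ = n * (p + 1) := by ring
    _ ≤ n * n := Nat.mul_le_mul_left n hp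

theorem computesTarget_reachTargetCmd {inp : List ℕ} {n k : ℕ} (h : IsInput inp n k) :
    ComputesTarget inp n k (reachEdge inp n k) reachTargetCmd := by
  intro s v a hv ha hE h7 h8 h10 h11 h13 h14
  obtain ⟨hp, -⟩ := div_lt_and_mod_lt hv
  simp only [reachTargetCmd, wp_block_cons, wp_block_nil, wp_op, Op.Valid, width, Op.run,
    Nat.reduceLT, true_and, Function.update_apply, Nat.reduceEqDiff, if_true, if_false, h8, h11,
    h13]
  refine ⟨h.index_lt hp ha, ?_, by omega⟩
  exact congrArg (· + _) (hE.mulStates _ (h.table _ hp _ ha))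

theorem computesTarget_pairTargetCmd {inp : List ℕ} {n k : ℕ} (h : IsInput inp n k) :
    ComputesTarget inp n k (pairEdge inp n k) pairTargetCmd := by
  intro s v a hv ha hE h7 h8 h10 h11 h13 h14
  obtain ⟨hp, hq⟩ := div_lt_and_mod_lt hv
  simp only [pairTargetCmd, wp_block_cons, wp_block_nil, wp_op, Op.Valid, width, Op.run,
    Nat.reduceLT, true_and, Function.update_apply, Nat.reduceEqDiff, if_true, if_false, h8,
    h13, h14]
  refine ⟨h.index_lt hp ha, h.index_lt hq ha, ?_, by omega⟩
  exact congrArg (· + _) (hE.mulStates _ (h.table _ hp _ ha))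

theorem reachEdge_lt {inp : List ℕ} {n k v a : ℕ} (h : IsInput inp n k) (hv : v < n * n)
    (ha : a < k) : reachEdge inp n k v a < n * n := by
  obtain ⟨hp, hq⟩ := div_lt_and_mod_lt hv
  exact mul_add_lt_mul_self (h.table _ hp _ ha) hq

theorem pairEdge_lt {inp : List ℕ} {n k v a : ℕ} (h : IsInput inp n k) (hv : v < n * n)
    (ha : a < k) : pairEdge inp n k v a < n * n := by
  obtain ⟨hp, hq⟩ := div_lt_and_mod_lt hv
  exact mul_add_lt_mul_self (h.table _ hp _ ha) (h.table _ hq _ ha)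

/-- The pair number `v` is represented as reachable. -/
def Reaches (inp : List ℕ) (n k : ℕ) : ℕ → Prop :=
  Derives (n * n) k 1 (reachEdge inp n k) fun v => v / n = v % n

/-- The states of the pair number `v` are represented as inequivalent. -/
def Differs (inp : List ℕ) (n k : ℕ) : ℕ → Prop :=
  Derives (n * n) k 1 (pairEdge inp n k) fun v => inp.getD (3 + v / n) 0 ≠ inp.getD (3 + v % n) 0

/-- The pair number `v` is represented as critical. -/
def Critical (inp : List ℕ) (n k v : ℕ) : Prop :=
  Reaches inp n k (n * inp.getD 2 0 + v / n) ∧ Reaches inp n k v ∧ Differs inp n k v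

/-- The pair number `v` is represented as safe. -/
def Safe (inp : List ℕ) (n k : ℕ) : ℕ → Prop :=
  Derives (n * n) k k (pairEdge inp n k) fun v => ¬ Critical inp n k v

/-- Register `12` receives `1 - |p - q|`, truncated, which is positive only on the diagonal. -/
def diagonalCmd : Cmd := .block [
  .op (.sub 12 10 11), .op (.sub 13 11 10), .op (.add 12 12 13), .op (.sub 12 2 12)]

/-- Register `12` receives the distance between the acceptance bits of the two states. -/
def separatedCmd : Cmd := .block [
  .op (.const 12 3), .op (.add 13 12 10), .op (.input 13 13), .op (.add 14 12 11),
  .op (.input 14 14), .op (.sub 12 13 14), .op (.sub 15 14 13), .op (.add 12 12 15)]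

/-- Register `12` receives the sum of three counters, for the pairs `(start, p)` and `(p, q)` in the
reachability array and `(p, q)` in the inequivalence array. A counter vanishes when its fact is
derived, so the sum is positive exactly when one of the three conditions of criticality fails. -/
def noncriticalCmd : Cmd := .block [
  .op (.get 12 2 4), .op (.add 12 12 10), .op (.get 12 11 12), .op (.get 13 11 7),
  .op (.add 12 12 13), .op (.get 13 12 7), .op (.add 12 12 13)]

theorem decides_diagonalCmd {inp : List ℕ} {n k c : ℕ} {s : Store} :
    Decides inp n k c (fun v => v / n = v % n) diagonalCmd s := by
  intro t v hv _ hE h7 h10 h11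
  simp only [diagonalCmd, wp_block_cons, wp_block_nil, wp_op, Op.Valid, Op.run,
    true_and, Function.update_apply, Nat.reduceEqDiff, if_true, if_false, h10, h11, hE.one]
  omega

theorem decides_separatedCmd {inp : List ℕ} {n k c : ℕ} {s : Store} (h : IsInput inp n k) :
    Decides inp n k c (fun v => inp.getD (3 + v / n) 0 ≠ inp.getD (3 + v % n) 0)
      separatedCmd s := by
  intro t v hv _ hE h7 h10 h11
  obtain ⟨hp, hq⟩ := div_lt_and_mod_lt hv
  simp only [separatedCmd, wp_block_cons, wp_block_nil, wp_op, Op.Valid, Op.run,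
    true_and, Function.update_apply, Nat.reduceEqDiff, if_true, if_false, h10, h11, h.length]
  omega

theorem decides_noncriticalCmd {inp : List ℕ} {n k : ℕ} {s : Store} (h : IsInput inp n k)
    (hR : ∀ v < n * n, s.arr 11 v = 0 ↔ Reaches inp n k v)
    (hD : ∀ v < n * n, s.arr 12 v = 0 ↔ Differs inp n k v) :
    Decides inp n k 13 (fun v => ¬ Critical inp n k v) noncriticalCmd s := by
  intro t v hv ha hE h7 h10 h11
  obtain ⟨hp, hq⟩ := div_lt_and_mod_lt hv
  simp only [noncriticalCmd, wp_block_cons, wp_block_nil, wp_op, Op.Valid, width, Op.run,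
    Nat.reduceLT, true_and, Function.update_apply, Nat.reduceEqDiff, if_true, if_false, h7, h10,
    hE.start, hE.mulStates _ h.start, ha 11 (by omega) (by omega), ha 12 (by omega) (by omega)]
  rw [Critical, ← hR _ hv, ← hR _ (mul_add_lt_mul_self h.start hp), ← hD _ hv]
  omega

/-- The program deciding whether all pairs of states are safe. -/
def mainCmd : Cmd := .block [
  setupCmd, buildCmd 4 5 6 reachTargetCmd, buildCmd 7 8 9 pairTargetCmd,
  initCmd 11 2 diagonalCmd, propagateCmd 11 4 5 6,
  initCmd 12 2 separatedCmd, propagateCmd 12 7 8 9,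
  initCmd 13 1 noncriticalCmd, propagateCmd 13 7 8 9]

/-- The thresholds are constant registers: register `2`, holding `1`, for the two existential
closures and register `1`, holding `k`, for the universal one, where `0 < k` is needed. Both
inequivalence and safety use the reversed pair graph in arrays `7` to `9`. -/
theorem wp_mainCmd {inp : List ℕ} {n k : ℕ} (h : IsInput inp n k) (hk : 0 < k) (s : Store)
    (hs : ∀ j i, s.arr j i = 0) :
    wp inp mainCmd (fun t => (¬ t.reg 9 < t.reg 6 ↔ ∀ v < n * n, Safe inp n k v) ∧
      t.time ≤ s.time + 300 * (k * n ^ 2)) s := by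
  have hn : 0 < n := by
    have := h.start
    omega
  rw [mainCmd, wp_block_cons]
  refine (wp_setupCmd h s).mono ?_
  rintro s₁ hA₁ ⟨hE₁, ht₁⟩
  rw [wp_block_cons]
  refine (wp_buildCmd (by decide) (by decide) (by decide) (computesTarget_reachTargetCmd h)
    (by decide) (by decide) hE₁ fun w => ?_).mono ?_
  · rw [hA₁.arr 4 (by decide), hs]
  rintro s₂ hA₂ ⟨hE₂, ⟨e, hC⟩, ht₂⟩
  rw [wp_block_cons]
  refine (wp_buildCmd (by decide) (by decide) (by decide) (computesTarget_pairTargetCmd h)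
    (by decide) (by decide) hE₂ fun w => ?_).mono ?_
  · rw [hA₂.arr 7 (by decide), hA₁.arr 7 (by decide), hs]
  rintro s₃ hA₃ ⟨hE₃, ⟨e', hC'⟩, ht₃⟩
  rw [wp_block_cons]
  refine (wp_initCmd (c := 11) (th := 2) (by decide) (by decide) (by decide) (by simp [hE₃.one])
    (by decide) decides_diagonalCmd (by decide) (by decide) hE₃).mono ?_
  rintro s₄ hA₄ ⟨hE₄, hP₄, ht₄⟩
  rw [wp_block_cons]
  refine (wp_propagateCmd (e := e) (T := reachEdge inp n k) (by decide) (by decide) (by decide)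
    (by decide) (by decide) (fun v hv a ha => reachEdge_lt h hv ha) (by simp [hE₃.one]) hE₄ ?_
    hP₄).mono ?_
  · simpa only [hA₄.arr 4 (by decide), hA₄.arr 5 (by decide), hA₄.arr 6 (by decide),
      hA₃.arr 4 (by decide), hA₃.arr 5 (by decide), hA₃.arr 6 (by decide)] using hC
  rintro s₅ hA₅ ⟨hE₅, hR, -, ht₅⟩
  rw [wp_block_cons]
  refine (wp_initCmd (c := 12) (th := 2) (by decide) (by decide) (by decide) (by simp [hE₅.one])
    (by decide) (decides_separatedCmd h) (by decide) (by decide) hE₅).mono ?_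
  rintro s₆ hA₆ ⟨hE₆, hP₆, ht₆⟩
  have keep₆ : ∀ j, 7 ≤ j → j < 10 → s₆.arr j = s₃.arr j := by
    intro j h₁ h₂
    interval_cases j <;>
      rw [hA₆.arr _ (by decide), hA₅.arr _ (by decide), hA₄.arr _ (by decide)]
  rw [wp_block_cons]
  refine (wp_propagateCmd (e := e') (T := pairEdge inp n k) (by decide) (by decide) (by decide)
    (by decide) (by decide) (fun v hv a ha => pairEdge_lt h hv ha) (by simp [hE₅.one]) hE₆ ?_
    hP₆).mono ?_
  · simpa only [keep₆ 7 (by omega) (by omega), keep₆ 8 (by omega) (by omega),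
      keep₆ 9 (by omega) (by omega)] using hC'
  rintro s₇ hA₇ ⟨hE₇, hD, -, ht₇⟩
  rw [hE₅.one] at hD
  rw [hE₃.one] at hR
  have hR₇ : ∀ v < n * n, s₇.arr 11 v = 0 ↔ Reaches inp n k v := by
    rw [hA₇.arr 11 (by decide), hA₆.arr 11 (by decide)]
    exact hR
  rw [wp_block_cons]
  refine (wp_initCmd (c := 13) (th := 1) (by decide) (by decide) (by decide)
    (by simpa [hE₇.letters] using hk) (by decide) (decides_noncriticalCmd h hR₇ hD) (by decide)
    (by decide) hE₇).mono ?_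
  rintro s₈ hA₈ ⟨hE₈, hP₈, ht₈⟩
  rw [hE₇.letters] at hP₈
  rw [wp_block_cons]
  refine (wp_propagateCmd (e := e') (T := pairEdge inp n k) (by decide) (by decide) (by decide)
    (by decide) (by decide) (fun v hv a ha => pairEdge_lt h hv ha) hk hE₈ ?_ hP₈).mono ?_
  · simpa only [hA₈.arr 7 (by decide), hA₈.arr 8 (by decide), hA₈.arr 9 (by decide),
      hA₇.arr 7 (by decide), hA₇.arr 8 (by decide), hA₇.arr 9 (by decide),
      keep₆ 7 (by omega) (by omega), keep₆ 8 (by omega) (by omega),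
      keep₆ 9 (by omega) (by omega)] using hC'
  rintro s₉ - ⟨hE₉, -, hS, ht₉⟩
  rw [wp_block_nil]
  refine ⟨?_, ?_⟩
  · rw [hE₉.pairs, not_lt]
    exact hS
  -- The nine bounds add up to `51 + 148 n^2 + 64 k n^2`, and both `1` and `n^2` are at most `k
  -- n^2`.
  · have h₁ : 1 ≤ n * n := Nat.mul_pos hn hn
    have h₂ : n * n ≤ k * (n * n) := Nat.le_mul_of_pos_left _ hk
    rw [pow_two] at ht₁ ⊢
    ring_nf at *
    omega

end RAM

/-! ### Encoded automata and the final program -/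

namespace RAM

section

variable {n k : ℕ} (A : DFA (Fin k) (Fin n))

theorem length_encode : (encode A).length = n + 3 + n * k := by
  simp [encode]
  omega

theorem getD_encode_accept {p : ℕ} (hp : p < n) :
    (encode A).getD (3 + p) 0 ≠ 0 ↔ (⟨p, hp⟩ : Fin n) ∈ A.accept := by
  classical
  rw [encode, List.append_assoc, List.getD_append_right _ _ _ _ (by simp)]
  rw [List.getD_append _ _ _ _ (by simp [hp]), List.getD_eq_getElem _ _ (by simp [hp])]
  simp

/-- Because entries are at most `1`, comparing them as numbers is the same as comparing acceptance.
-/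
theorem getD_encode_accept_le {p : ℕ} (hp : p < n) : (encode A).getD (3 + p) 0 ≤ 1 := by
  classical
  rw [encode, List.append_assoc, List.getD_append_right _ _ _ _ (by simp)]
  rw [List.getD_append _ _ _ _ (by simp [hp]), List.getD_eq_getElem _ _ (by simp [hp])]
  simp
  split_ifs <;> simp

theorem tableEntry_encode (p : Fin n) (a : Fin k) :
    tableEntry (encode A) n k p a = A.step p a := by
  have hlt : k * p + a < n * k :=
    calc k * p + a < k * p + k := by omega
      _ = (p + 1) * k := by ring
      _ ≤ n * k := Nat.mul_le_mul_right k p.2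
  rw [tableEntry, encode, List.getD_append_right _ _ _ _ (by simp; omega),
    List.getD_eq_getElem _ _ (by simp; omega)]
  simp only [List.length_append, List.length_cons, List.length_nil, List.length_ofFn,
    List.getElem_ofFn]
  have e : n + 3 + k * p + a - (0 + 1 + 1 + 1 + n) = k * p + a := by omega
  congr 2
  · ext
    simp only [Fin.coe_divNat, e]
    rw [Nat.mul_add_div (by omega), Nat.div_eq_of_lt a.2, add_zero]
  · ext
    simp only [Fin.coe_modNat, e]
    rw [Nat.mul_add_mod, Nat.mod_eq_of_lt a.2]

theorem isInput_encode : IsInput (encode A) n k where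
  length := length_encode A
  states := by simp [encode]
  letters := by simp [encode]
  start := by simp [encode]
  table p hp a ha := by
    rw [tableEntry_encode A ⟨p, hp⟩ ⟨a, ha⟩]
    exact Fin.is_lt _

theorem start_encode : (encode A).getD 2 0 = A.start := by simp [encode]

/-- The number of a pair of states. -/
def pairIndex (p q : Fin n) : ℕ := n * p + q

theorem pairIndex_lt (p q : Fin n) : pairIndex p q < n * n := mul_add_lt_mul_self p.2 q.2

theorem pairIndex_div (p q : Fin n) : pairIndex p q / n = p := by
  rw [pairIndex, Nat.mul_add_div p.pos, Nat.div_eq_of_lt q.2, add_zero]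

theorem pairIndex_mod (p q : Fin n) : pairIndex p q % n = q := by
  rw [pairIndex, Nat.mul_add_mod, Nat.mod_eq_of_lt q.2]

theorem exists_pairIndex_eq {v : ℕ} (hv : v < n * n) : ∃ p q : Fin n, pairIndex p q = v := by
  obtain ⟨hp, hq⟩ := div_lt_and_mod_lt hv
  exact ⟨⟨_, hp⟩, ⟨_, hq⟩, Nat.div_add_mod v n⟩

theorem reachEdge_pairIndex (p q : Fin n) (a : Fin k) :
    reachEdge (encode A) n k (pairIndex p q) a = pairIndex (A.step p a) q := by
  rw [reachEdge, pairIndex_div, pairIndex_mod, tableEntry_encode, pairIndex]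

theorem pairEdge_pairIndex (p q : Fin n) (a : Fin k) :
    pairEdge (encode A) n k (pairIndex p q) a = pairIndex (A.step p a) (A.step q a) := by
  rw [pairEdge, pairIndex_div, pairIndex_mod, tableEntry_encode, tableEntry_encode, pairIndex]

theorem Derives.step_one {N k u : ℕ} {T : ℕ → ℕ → ℕ} {I : ℕ → Prop} (hu : u < N) (a : Fin k)
    (h : Derives N k 1 T I (T u a)) : Derives N k 1 T I u :=
  .step {(a : ℕ)} hu (by simp) (by simp) (by simpa using h)

/-- A derivation is a path in the first component, with the target kept fixed in the second, that
ends on the diagonal. -/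
theorem reaches_pairIndex_iff (p q : Fin n) :
    Reaches (encode A) n k (pairIndex p q) ↔ ∃ y, A.evalFrom p y = q := by
  constructor
  · intro h
    generalize hv : pairIndex p q = v at h
    induction h generalizing p with
    | init hu hI =>
      subst hv
      rw [pairIndex_div, pairIndex_mod] at hI
      exact ⟨[], Fin.ext hI⟩
    | @step u B hu hB hc _ ih =>
      subst hv
      obtain ⟨a, ha⟩ := Finset.card_pos.1 hc
      have hak : a < k := Finset.mem_range.1 (hB ha)
      obtain ⟨y, hy⟩ := ih a ha (A.step p ⟨a, hak⟩) (reachEdge_pairIndex A p q ⟨a, hak⟩).symm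
      exact ⟨⟨a, hak⟩ :: y, hy⟩
  · rintro ⟨y, hy⟩
    induction y generalizing p with
    | nil =>
      refine .init (pairIndex_lt p q) ?_
      rw [pairIndex_div, pairIndex_mod]
      exact congrArg Fin.val hy
    | cons a y ih =>
      refine .step_one (pairIndex_lt p q) a ?_
      rw [reachEdge_pairIndex]
      exact ih _ hy

/-- A derivation spells a separating word: the base case separates by the empty word, each step
prepends a letter. -/
theorem differs_pairIndex_iff (p q : Fin n) :
    Differs (encode A) n k (pairIndex p q) ↔ A.acceptsFrom p ≠ A.acceptsFrom q := by
  have hacc : ∀ p q : Fin n, (encode A).getD (3 + pairIndex p q / n) 0 ≠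
      (encode A).getD (3 + pairIndex p q % n) 0 ↔ ¬ (p ∈ A.accept ↔ q ∈ A.accept) := by
    intro p q
    rw [pairIndex_div, pairIndex_mod, ← getD_encode_accept A p.2, ← getD_encode_accept A q.2]
    have := getD_encode_accept_le A p.2
    have := getD_encode_accept_le A q.2
    omega
  constructor
  · intro h
    generalize hv : pairIndex p q = v at h
    induction h generalizing p q with
    | init hu hI =>
      subst hv
      intro he
      have := Set.ext_iff.1 he []
      exact (hacc p q).1 hI this
    | @step u B hu hB hc _ ih =>
      subst hv
      obtain ⟨a, ha⟩ := Finset.card_pos.1 hc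
      have hak : a < k := Finset.mem_range.1 (hB ha)
      intro he
      exact ih a ha _ _ (pairEdge_pairIndex A p q ⟨a, hak⟩).symm
        (A.acceptsFrom_evalFrom_congr he [⟨a, hak⟩])
  · intro h
    have : ∃ z, ¬ (z ∈ A.acceptsFrom p ↔ z ∈ A.acceptsFrom q) := by
      by_contra! hn
      exact h (Set.ext hn)
    obtain ⟨z, hz⟩ := this
    clear h
    induction z generalizing p q with
    | nil => exact .init (pairIndex_lt p q) ((hacc p q).2 hz)
    | cons a z ih =>
      refine .step_one (pairIndex_lt p q) a ?_
      rw [pairEdge_pairIndex]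
      exact ih _ _ hz

theorem critical_pairIndex_iff (p q : Fin n) :
    Critical (encode A) n k (pairIndex p q) ↔ A.IsCritical p q := by
  rw [Critical, start_encode, pairIndex_div, reaches_pairIndex_iff, differs_pairIndex_iff]
  exact and_congr_left' (reaches_pairIndex_iff A A.start p)

theorem safe_pairIndex_iff (p q : Fin n) :
    Safe (encode A) n k (pairIndex p q) ↔ A.SafePair p q := by
  constructor
  · intro h
    generalize hv : pairIndex p q = v at h
    induction h generalizing p q with
    | init hu hI =>
      subst hv
      exact .base (mt (critical_pairIndex_iff A p q).2 hI)
    | @step u B hu hB hc _ ih =>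
      subst hv
      -- A set of at least `k` letters contains all of them, so threshold `k` expresses the
      -- quantifier over letters.
      have hB' := Finset.eq_of_subset_of_card_le hB (by simpa using hc)
      refine .step fun a => ih a ?_ _ _ (pairEdge_pairIndex A p q a).symm
      rw [hB']
      exact Finset.mem_range.2 a.2
  · intro h
    induction h with
    | @base p q h => exact .init (pairIndex_lt p q) (mt (critical_pairIndex_iff A p q).1 h)
    | @step p q _ ih =>
      refine .step (Finset.range k) (pairIndex_lt p q) (Finset.Subset.refl _) (by simp) ?_
      intro a ha
      have := pairEdge_pairIndex A p q ⟨a, Finset.mem_range.1 ha⟩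
      simp only at this
      rw [this]
      exact ih _

theorem forall_safe_iff :
    (∀ v < n * n, Safe (encode A) n k v) ↔ A.accepts.IsGeneralizedDefinite := by
  rw [A.isGeneralizedDefinite_accepts_iff]
  constructor
  · intro h p q
    exact (safe_pairIndex_iff A p q).1 (h _ (pairIndex_lt p q))
  · intro h v hv
    obtain ⟨p, q, rfl⟩ := exists_pairIndex_eq hv
    exact (safe_pairIndex_iff A p q).2 (h p q)

end

/-- Instructions putting `n + 3 + n * k`, the length of the input, into register `1`. -/
def prelude : Program := [
  .const 0 1, .load 2 5, .load 3 0, .const 1 3, .add 1 1 2, .jumpLt 4 2 7, .jump 10,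
  .add 1 1 3, .add 4 4 0, .jump 5]

/-- The product `n * k` is summed in `n` rounds of four steps, with five steps before and two on
exit. The result is the base address of the arrays, just past the input. -/
theorem iterate_step_prelude {P : Program} (hP : P.HasCodeAt 0 prelude) {inp : List ℕ} {n k : ℕ}
    (h : IsInput inp n k) : ∃ t ≤ 4 * n + 7, (P.step^[t] (init inp)).pc = prelude.length ∧
      (P.step^[t] (init inp)).reg 1 = n + 3 + n * k ∧
      (P.step^[t] (init inp)).mem = (init inp).mem := by
  have hP' : ∀ i (hi : i < prelude.length), P[i]? = some prelude[i] := by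
    simpa [Program.HasCodeAt] using hP
  have h0 := hP' 0 (by decide)
  have h1 := hP' 1 (by decide)
  have h2 := hP' 2 (by decide)
  have h3 := hP' 3 (by decide)
  have h4 := hP' 4 (by decide)
  have h5 := hP' 5 (by decide)
  have h6 := hP' 6 (by decide)
  have h7 := hP' 7 (by decide)
  have h8 := hP' 8 (by decide)
  have h9 := hP' 9 (by decide)
  have key : ∀ d i (σ : Config), i + d = n → σ.pc = 5 → σ.reg 0 = 1 → σ.reg 2 = n →
      σ.reg 3 = k → σ.reg 4 = i → σ.reg 1 = n + 3 + i * k → ∃ t ≤ 4 * d + 2,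
        (P.step^[t] σ).pc = prelude.length ∧ (P.step^[t] σ).reg 1 = n + 3 + n * k ∧
        (P.step^[t] σ).mem = σ.mem := by
    intro d
    induction d with
    | zero =>
      intro i σ hi hpc r0 r2 r3 r4 r1
      have hs : P.step^[2] σ = ⟨10, σ.reg, σ.mem⟩ := by
        simp [Program.step, hpc, h5, h6, prelude, Instr.exec, r2, r4, show ¬ i < n by omega]
      refine ⟨2, le_rfl, ?_⟩
      rw [hs]
      exact ⟨rfl, by rw [r1, show i = n by omega], rfl⟩
    | succ d ih =>
      intro i σ hi hpc r0 r2 r3 r4 r1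
      have hs : P.step^[4] σ = ⟨5, Function.update (Function.update σ.reg 1 (σ.reg 1 + k)) 4 (i + 1),
          σ.mem⟩ := by
        simp [Program.step, hpc, h5, h7, h8, h9, prelude, Instr.exec, r0, r2, r3, r4,
          show i < n by omega]
      obtain ⟨t, ht, h⟩ := ih (i + 1) (P.step^[4] σ) (by omega) (by rw [hs]) (by simp [hs, r0])
        (by simp [hs, r2]) (by simp [hs, r3]) (by simp [hs]) (by simp [hs, r1]; ring)
      rw [← Function.iterate_add_apply] at h
      refine ⟨t + 4, by omega, h.1, h.2.1, ?_⟩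
      rw [h.2.2, hs]
  have hm0 : (init inp).mem 0 = n := h.states
  have hm1 : (init inp).mem 1 = k := h.letters
  have hs : P.step^[5] (init inp) = ⟨5, Function.update (Function.update (Function.update
      (Function.update (Function.update (init inp).reg 0 1) 2 n) 3 k) 1 3) 1 (3 + n),
      (init inp).mem⟩ := by
    have hpc : (init inp).pc = 0 := rfl
    have hr : ∀ r, (init inp).reg r = 0 := fun _ => rfl
    simp [Program.step, hpc, h0, h1, h2, h3, h4, prelude, Instr.exec, hr, hm0, hm1]
  obtain ⟨t, ht, h⟩ := key n 0 (P.step^[5] (init inp)) (by omega) (by rw [hs]) (by simp [hs])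
    (by simp [hs]) (by simp [hs]) (by rw [hs]; simp [init]) (by simp [hs]; omega)
  rw [← Function.iterate_add_apply] at h
  refine ⟨t + 5, by omega, h.1, h.2.1, ?_⟩
  rw [h.2.2, hs]

/-- The program deciding generalized definiteness. -/
def genDefProgram : Program :=
  prelude ++ mainCmd.compile prelude.length ++
    [.jumpLt 11 8 (prelude.length + mainCmd.size + 2), .halt true, .halt false]

/-- Simulation costs at most `20 * 300 = 6000` times `k n^2`; the prelude and the final comparison
add at most `4 * n + 8` steps. -/
theorem genDefProgram_answersWithin {inp : List ℕ} {n k : ℕ} (h : IsInput inp n k) (hk : 0 < k)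
    {b : Bool} (hb : b = true ↔ ∀ v < n * n, Safe inp n k v) :
    genDefProgram.AnswersWithin inp b (7000 * (k * n ^ 2)) := by
  set P := genDefProgram with hPdef
  have hcode : P.HasCodeAt prelude.length (mainCmd.compile prelude.length) :=
    Program.hasCodeAt_self_append _ _ _
  have hend : P.HasCodeAt (prelude.length + mainCmd.size)
      [.jumpLt 11 8 (prelude.length + mainCmd.size + 2), .halt true, .halt false] := by
    have := Program.hasCodeAt_self_append (prelude ++ mainCmd.compile prelude.length)
      [.jumpLt 11 8 (prelude.length + mainCmd.size + 2), .halt true, .halt false] []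
    simpa [hPdef, genDefProgram] using this
  have hpre : P.HasCodeAt 0 prelude := by
    have := Program.hasCodeAt_self_append [] prelude (mainCmd.compile prelude.length ++
      [.jumpLt 11 8 (prelude.length + mainCmd.size + 2), .halt true, .halt false])
    simpa [hPdef, genDefProgram] using this
  obtain ⟨t₁, ht₁, hpc₁, hreg₁, hmem₁⟩ := iterate_step_prelude hpre h
  set σ := P.step^[t₁] (init inp) with hσ
  have hlen : inp.length = n + 3 + n * k := h.length
  -- Memory beyond the input is zero, so all arrays start empty; the values left by the prelude in
  -- the other registers are immaterial.
  have hrep : Represents inp inp.length ⟨fun r => σ.reg (r + 2), fun _ _ => 0, 0⟩ σ := by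
    refine ⟨by rw [hreg₁, hlen], le_rfl, fun _ => rfl, fun j i _ => ?_, fun i _ => ?_⟩
    · rw [hmem₁]
      exact List.getD_eq_default _ _ (by omega)
    · rw [hmem₁]
      rfl
  obtain ⟨s, hexec, hs, hst⟩ := wp_mainCmd h hk ⟨fun r => σ.reg (r + 2), fun _ _ => 0, 0⟩
    fun _ _ => rfl
  obtain ⟨t₂, ht₂, hpc₂, hrep₂⟩ := hexec.simulate (by rw [hpc₁]; exact hcode) hrep
  rw [hσ, ← Function.iterate_add_apply] at hpc₂ hrep₂
  rw [← hσ, hpc₁] at hpc₂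
  set τ := P.step^[t₂ + t₁] (init inp) with hτ
  simp only [Program.hasCodeAt_cons] at hend
  obtain ⟨e₀, e₁, e₂, -⟩ := hend
  have r9 : τ.reg 11 = s.reg 9 := hrep₂.reg 9
  have r6 : τ.reg 8 = s.reg 6 := hrep₂.reg 6
  refine ⟨t₂ + t₁ + 1, ?_, ?_⟩
  · have hn : 1 ≤ n := by
      have := h.start
      omega
    have h₁ : n ≤ n ^ 2 := Nat.le_self_pow two_ne_zero n
    have h₂ : n ^ 2 ≤ k * n ^ 2 := Nat.le_mul_of_pos_left _ hk
    simp only at ht₂ hst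
    omega
  · rw [Function.iterate_succ_apply', ← hτ]
    by_cases hlt : s.reg 9 < s.reg 6
    · have hbf : b = false := by
        rw [← Bool.not_eq_true, hb, ← hs]
        exact fun h => h hlt
      have : P.step τ = ⟨prelude.length + mainCmd.size + 2, τ.reg, τ.mem⟩ := by
        simp [Program.step, hpc₂, e₀, Instr.exec, r9, r6, hlt]
      rw [this, hbf]
      exact e₂
    · have hbt : b = true := hb.2 (hs.1 hlt)
      have : P.step τ = ⟨prelude.length + mainCmd.size + 1, τ.reg, τ.mem⟩ := by
        simp [Program.step, hpc₂, e₀, Instr.exec, r9, r6, hlt]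
      rw [this, hbt]
      exact e₁

end RAM

open Classical in
theorem mainTheorem3 :
    ∃ (P : RAM.Program) (C : ℕ), ∀ (n k : ℕ), 0 < k → ∀ A : DFA (Fin k) (Fin n),
      P.AnswersWithin (RAM.encode A) (decide A.accepts.IsGeneralizedDefinite) (C * (k * n ^ 2)) := by
  refine ⟨RAM.genDefProgram, 7000, fun n k hk A => ?_⟩
  refine RAM.genDefProgram_answersWithin (RAM.isInput_encode A) hk ?_
  rw [decide_eq_true_iff, RAM.forall_safe_iff]
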